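/- Let $d\ge 2$, $m\in\mathbb N=\{0,1,2,\dots\}$, and write points of $\mathbb R^d$ as $x=(x_1,\xi)$ with $x_1\in\mathbb R$, $\xi\in\mathbb R^{d-1}$. Let $U\subset\mathbb R^d$ be an open set containing $[0,+\infty)\times\mathbb R^{d-1}$, let $\mathbf a\in C^{m+1}(U;\mathbb R^d)$ satisfy $\mathbf a_1(0,\xi)>0$ for all $\xi\in\mathbb R^{d-1}$, and let $a_0,S\in C^m(U)$ and $g\in C^m(\mathbb R^{d-1})$. For $\xi\in\mathbb R^{d-1}$ let $x_\xi$ be the maximal solution in $U$ of $x_\xi'(s)=\mathbf a(x_\xi(s))$, $x_\xi(0)=(0,\xi)$, defined on $(T_{\min}(\xi),T_{\max}(\xi))$. Put $\Omega=\{(s,\xi):\ T_{\min}(\xi)<s<T_{\max}(\xi)\}$ and $\Phi(s,\xi)=x_\xi(s)$ for $(s,\xi)\in\Omega$. Let $\ell>0$ be such that $\Omega_\ell:=(-\ell,+\infty)\times\mathbb R^{d-1}\subset\Omega$, and put $\widetilde U_\ell:=\Phi(\Omega_\ell)$. Then: (i) $\widetilde U_\ell$ is an open subset of $U$ and $\Phi:\Omega_\ell\to\widetilde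 U_\ell$ is a $C^{m+1}$ diffeomorphism. (ii) The problem $$\operatorname{div}(\mathbf a u)+a_0u=S\ \text{ on }\widetilde U_\ell,\qquad u(0,\xi)=g(\xi)\quad\forall\,\xi\in\mathbb R^{d-1},$$ is well-posed, with solution in $C^m(\widetilde U_\ell)$. That is: call $u$ a weak solution if $u$ is continuous on $\widetilde U_\ell$, $u(0,\xi)=g(\xi)$ for all $\xi$, and $$\int\big(-u\,\mathbf a\cdot\nabla\varphi+a_0u\varphi\big)\,dx=\int S\varphi\,dx\qquad\text{for all }\varphi\in C^1_c(\widetilde U_\ell);$$ call $u$ a classical solution if $u\in C^1(\widetilde U_\ell)$ and both equations hold pointwise. Then - (existence and regularity) there is a weak solution $u\in C^m(\widetilde U_\ell)$, which is a classical solution if $m\ge1$; - (uniqueness) every weak solution and every classical solution coincides with $u$ on $\widetilde U_\ell$; - (continuous dependence on the data) for every $0\le k\le m$, if $g_n\in C^m(\mathbb R^{d-1})$ and $S_n\in C^m(\widetilde U_\ell)$ satisfy $g_n\to g$ in $C^k(\mathbb R^{d-1})$ and $S_n\to S$ in $C^k(\widetilde U_\ell)$, and if $u_n$ is a weak solution of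 the problem with data $(g_n,S_n)$, then $u_n\to u$ in $C^k(\widetilde U_\ell)$. Here convergence in $C^k$ means uniform convergence on compact subsets of all derivatives of order at most $k$. -/

import Mathlib

noncomputable section

namespace Transport

/-- The transverse space `ℝ^(d-1)`. -/
abbrev Transverse (d : ℕ) : Type := EuclideanSpace ℝ (Fin (d - 1))

/-- `ℝ^d`, whose points are written `x = (x₁, ξ)` with `x₁ ∈ ℝ` and `ξ ∈ ℝ^(d-1)`. -/
abbrev Space (d : ℕ) : Type := ℝ × Transverse d

/-- `div F = ∂F₁/∂x₁ + ∑ j, ∂F_{j+1}/∂ξ_j`. -/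
def divergence {d : ℕ} (F : Space d → Space d) (x : Space d) : ℝ :=
  (fderiv ℝ F x (1, 0)).1 +
    ∑ j : Fin (d - 1), (fderiv ℝ F x (0, EuclideanSpace.single j 1)).2 j

/-- `x` solves `x' = a(x)`, `x(0) = (0, ξ)`, inside `U`, on the open interval `I ∋ 0`. -/
structure IsCharacteristic {d : ℕ} (a : Space d → Space d) (U : Set (Space d))
    (ξ : Transverse d) (I : Set ℝ) (x : ℝ → Space d) : Prop where
  isOpen : IsOpen I
  ordConnected : I.OrdConnected
  zero_mem : (0 : ℝ) ∈ I
  init : x 0 = (0, ξ)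
  mem : ∀ s ∈ I, x s ∈ U
  hasDerivAt : ∀ s ∈ I, HasDerivAt x (a (x s)) s

/-- The domain `Ω` of the flow: `(s, ξ) ∈ Ω` when `s` lies in the maximal interval of existence
`(T_min(ξ), T_max(ξ))`, which is the union of the intervals of all solutions starting at
`(0, ξ)`. -/
def flowDomain {d : ℕ} (a : Space d → Space d) (U : Set (Space d)) :
    Set (ℝ × Transverse d) :=
  {p | ∃ (x : ℝ → Space d) (I : Set ℝ), IsCharacteristic a U p.2 I x ∧ p.1 ∈ I}

open Classical in
/-- The flow `Φ(s, ξ) = x_ξ(s)`, where `x_ξ` is the maximal solution starting at `(0, ξ)`: the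
common value at `s` of all solutions from `(0, ξ)` whose interval contains `s`
(see `flow_isCharacteristic` and `IsCharacteristic.eq_flow`). Outside `Ω` the value is
irrelevant. -/
def flow {d : ℕ} (a : Space d → Space d) (U : Set (Space d))
    (p : ℝ × Transverse d) : Space d :=
  if h : p ∈ flowDomain a U then h.choose p.1 else 0

theorem IsCharacteristic.eqOn {d : ℕ} {a : Space d → Space d} {U : Set (Space d)}
    (hU : IsOpen U) (ha : ContDiffOn ℝ 1 a U) {ξ : Transverse d} {I J : Set ℝ}
    {x y : ℝ → Space d} (hx : IsCharacteristic a U ξ I x) (hy : IsCharacteristic a U ξ J y) :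
    Set.EqOn x y (I ∩ J) := by
  suffices hsub : I ∩ J ⊆ {t | x t = y t} ∩ (I ∩ J) from fun t ht => (hsub ht).1
  have hc : IsPreconnected (I ∩ J) := (hx.ordConnected.inter hy.ordConnected).isPreconnected
  have h0 : (0 : ℝ) ∈ I ∩ J := ⟨hx.zero_mem, hy.zero_mem⟩
  have hop : IsOpen (I ∩ J) := hx.isOpen.inter hy.isOpen
  have hcx : ∀ t ∈ I ∩ J, ContinuousAt x t := fun t ht => (hx.hasDerivAt t ht.1).continuousAt
  have hcy : ∀ t ∈ I ∩ J, ContinuousAt y t := fun t ht => (hy.hasDerivAt t ht.2).continuousAt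
  refine hc.subset_of_closure_inter_subset ?_ ⟨0, h0, hx.init.trans hy.init.symm, h0⟩ ?_
  · rw [isOpen_iff_mem_nhds]
    rintro t ⟨hxy, ht⟩
    have hxy : x t = y t := hxy
    obtain ⟨K, s, hs, hK⟩ :=
      (ha.contDiffAt (hU.mem_nhds (hx.mem t ht.1))).exists_lipschitzOnWith
    have hev : x =ᶠ[nhds t] y := by
      refine ODE_solution_unique_of_eventually (v := fun _ => a) (s := fun _ => s) (K := K)
        (Filter.Eventually.of_forall fun _ => hK) ?_ ?_ hxy
      · filter_upwards [hop.mem_nhds ht, hcx t ht hs] with r hr hr'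
        exact ⟨hx.hasDerivAt r hr.1, hr'⟩
      · filter_upwards [hop.mem_nhds ht, hcy t ht (hxy ▸ hs)] with r hr hr'
        exact ⟨hy.hasDerivAt r hr.2, hr'⟩
    exact Filter.inter_mem hev (hop.mem_nhds ht)
  · rintro t ⟨htc, ht⟩
    refine ⟨?_, ht⟩
    by_contra hne
    have hne' : ∀ᶠ r in nhds t, x r ≠ y r := (hcx t ht).ne_iff_eventually_ne (hcy t ht) |>.1 hne
    obtain ⟨r, hr, hr'⟩ := mem_closure_iff_nhds.1 htc _ hne'
    exact hr hr'.1

theorem IsCharacteristic.eq_flow {d : ℕ} {a : Space d → Space d} {U : Set (Space d)}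
    (hU : IsOpen U) (ha : ContDiffOn ℝ 1 a U) {ξ : Transverse d} {I : Set ℝ}
    {x : ℝ → Space d} (hx : IsCharacteristic a U ξ I x) {s : ℝ} (hs : s ∈ I) :
    (s, ξ) ∈ flowDomain a U ∧ flow a U (s, ξ) = x s := by
  have h : (s, ξ) ∈ flowDomain a U := ⟨x, I, hx, hs⟩
  refine ⟨h, ?_⟩
  obtain ⟨J, hy, hsJ⟩ := h.choose_spec
  rw [flow, dif_pos h]
  exact hy.eqOn hU ha hx ⟨hsJ, hs⟩

theorem flow_isCharacteristic {d : ℕ} {a : Space d → Space d} {U : Set (Space d)}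
    (hU : IsOpen U) (ha : ContDiffOn ℝ 1 a U) {ξ : Transverse d}
    (h0 : (0, ξ) ∈ flowDomain a U) :
    IsCharacteristic a U ξ {s | (s, ξ) ∈ flowDomain a U} (fun s => flow a U (s, ξ)) := by
  have hsub : ∀ {I : Set ℝ} {x : ℝ → Space d}, IsCharacteristic a U ξ I x →
      I ⊆ {s | (s, ξ) ∈ flowDomain a U} := fun hx s hs => (hx.eq_flow hU ha hs).1
  refine ⟨?_, ?_, h0, ?_, ?_, ?_⟩
  · rw [isOpen_iff_mem_nhds]
    rintro s ⟨x, I, hx, hs⟩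
    exact Filter.mem_of_superset (hx.isOpen.mem_nhds hs) (hsub hx)
  · rw [Set.ordConnected_iff_uIcc_subset]
    rintro s ⟨x, I, hx, hs⟩ t ⟨y, J, hy, ht⟩ r hr
    have h1 := hx.ordConnected.uIcc_subset hx.zero_mem hs
    have h2 := hy.ordConnected.uIcc_subset hy.zero_mem ht
    rcases Set.uIcc_subset_uIcc_union_uIcc (a := s) (b := 0) (c := t) hr with h | h
    · exact hsub hx (h1 (Set.uIcc_comm s 0 ▸ h))
    · exact hsub hy (h2 h)
  · obtain ⟨x, I, hx, hs⟩ := h0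
    exact (hx.eq_flow hU ha hs).2.trans hx.init
  · rintro s ⟨x, I, hx, hs⟩
    simpa only [(hx.eq_flow hU ha hs).2] using hx.mem s hs
  · rintro s ⟨x, I, hx, hs⟩
    have hev : (fun s => flow a U (s, ξ)) =ᶠ[nhds s] x := by
      filter_upwards [hx.isOpen.mem_nhds hs] with r hr using (hx.eq_flow hU ha hr).2
    simpa only [(hx.eq_flow hU ha hs).2] using
      (hx.hasDerivAt s hs).congr_of_eventuallyEq hev

/-- `Ω_ℓ = (-ℓ, +∞) × ℝ^(d-1)`. -/
def strip (d : ℕ) (l : ℝ) : Set (ℝ × Transverse d) := Set.Ioi (-l) ×ˢ Set.univ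

/-- `Ũ_ℓ = Φ(Ω_ℓ)`. -/
def flowImage {d : ℕ} (a : Space d → Space d) (U : Set (Space d)) (l : ℝ) : Set (Space d) :=
  flow a U '' strip d l

/-- `f` restricts to a `C^k` diffeomorphism of the open set `s` onto the open set `t`. -/
def IsDiffeoOn {X Y : Type*} [NormedAddCommGroup X] [NormedSpace ℝ X]
    [NormedAddCommGroup Y] [NormedSpace ℝ Y] (k : ℕ) (f : X → Y) (s : Set X) (t : Set Y) :
    Prop :=
  IsOpen s ∧ IsOpen t ∧ Set.BijOn f s t ∧ ContDiffOn ℝ k f s ∧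
    ∃ f' : Y → X, Set.InvOn f' f s t ∧ ContDiffOn ℝ k f' t

/-- Classical solutions on `V` of `div(a u) + a₀ u = S`, `u(0, ξ) = g(ξ)`. -/
structure IsClassicalSolution {d : ℕ} (a : Space d → Space d) (a₀ S : Space d → ℝ)
    (g : Transverse d → ℝ) (V : Set (Space d)) (u : Space d → ℝ) : Prop where
  contDiffOn : ContDiffOn ℝ 1 u V
  equation : ∀ x ∈ V, divergence (fun y => u y • a y) x + a₀ x * u x = S x
  boundary : ∀ ξ : Transverse d, u (0, ξ) = g ξ

/-- Continuous weak solutions on `V` of `div(a u) + a₀ u = S`, `u(0, ξ) = g(ξ)`: the equation is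
tested against compactly supported functions `φ` of class `C¹` on `V`,
`∫ (- u (a · ∇φ) + a₀ u φ) = ∫ S φ`, and the boundary values are pointwise. -/
structure IsWeakSolution {d : ℕ} (a : Space d → Space d) (a₀ S : Space d → ℝ)
    (g : Transverse d → ℝ) (V : Set (Space d)) (u : Space d → ℝ) : Prop where
  continuousOn : ContinuousOn u V
  equation : ∀ φ : Space d → ℝ, ContDiff ℝ 1 φ → HasCompactSupport φ → tsupport φ ⊆ V →
    ∫ x, (-(u x * fderiv ℝ φ x (a x)) + a₀ x * u x * φ x) = ∫ x, S x * φ x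
  boundary : ∀ ξ : Transverse d, u (0, ξ) = g ξ

/-- `f n → f` in `C^k(V)`, `V` open: all derivatives of order at most `k` converge uniformly on
the compact subsets of `V`. -/
def TendstoCk {X : Type*} [NormedAddCommGroup X] [NormedSpace ℝ X] (k : ℕ) (V : Set X)
    (f : ℕ → X → ℝ) (f_lim : X → ℝ) : Prop :=
  ∀ j ≤ k, ∀ K ⊆ V, IsCompact K →
    TendstoUniformlyOn (fun n => iteratedFDeriv ℝ j (f n)) (iteratedFDeriv ℝ j f_lim)
      Filter.atTop K

end Transport

end

/-!
The flow `Φ` maps the strip `Ω_ℓ` diffeomorphically onto `Ũ_ℓ` and turns the transport equation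
into a family of linear ordinary differential equations in `s`, one for each `ξ`, which are solved
by an explicit formula.

*Regularity of the flow.* For a `C^k` vector field the superposition operator `γ ↦ a ∘ γ` is `C^k`
on `C([0, 1], E)` (`contDiffOn_superposition`). The path `γ(t) = y(τ t)` of a solution `y` starting
at `x` satisfies `γ = x + τ ∫ a(γ)`, an equation whose derivative in `γ` at `τ = 0` is the identity;
the implicit function theorem makes `γ` a `C^k` function of `(x, τ)`
(`exists_contDiffOn_localFlow`). Local flows carry the regularity of `Φ`, and the injectivity of
its derivative, along each trajectory from `s = 0`, where both are clear because `a₁ > 0`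
(`contDiffAt_flow_and_injective`). Again because `a₁ > 0` on `{x₁ = 0}`, a trajectory meets that
hyperplane only once, so that `Φ` is injective (`injOn_flow`).

*Weak solutions.* With `J = |det DΦ|`, the change of variables `x = Φ(s, ξ)` and the
du Bois-Reymond lemma show that, for continuous `u` and `h`, the equation `div(a u) + h = 0` holds
weakly on `Ũ_ℓ` if and only if `∂_s (J u ∘ Φ) = -J h ∘ Φ` holds pointwise
(`forall_integral_eq_zero_iff_hasDerivAt_flow`). Taking `u = 1` and `h = -div a`, for which the weak
equation is the divergence theorem, gives Liouville's formula `∂_s J = J (div a) ∘ Φ`. Hence `u` is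
a weak solution if and only if `∂_s (u ∘ Φ) = (S - (div a + a₀) u) ∘ Φ` (`weak_equation_iff`).
Existence, uniqueness and regularity are read off from the solution formula `lineSolution`.

*Continuous dependence.* A sequence of `C^k` functions converges in `C^k` exactly when it is a `C^k`
function with values in the Banach space `C(ℕ ∪ {∞}, ℝ)` of convergent sequences
(`TendstoCk.exists_contDiffOn`, `tendstoCk_eval`). The solution formula for data with values in that
space therefore yields the convergence of the solutions (`tendstoCk_of_isWeakSolution`).
-/

noncomputable section

namespace Transport

open Set Filter Topology MeasureTheory

/-! ### Superposition operators on spaces of continuous functions -/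

section Superposition

universe u

variable {T : Type*} [TopologicalSpace T]
  {E F : Type u} [NormedAddCommGroup E] [NormedSpace ℝ E] [NormedAddCommGroup F] [NormedSpace ℝ F]

/-- The family `h t`, `t ∈ T`, is of class `C^k` on `V`, with all derivatives of order at most `k`
continuous in the pair `(t, x)`. -/
structure JointContDiffOn (k : ℕ) (h : T → E → F) (V : Set E) : Prop where
  contDiffOn : ∀ t, ContDiffOn ℝ k (h t) V
  continuousOn : ∀ j ≤ k,
    ContinuousOn (fun p : T × E => iteratedFDeriv ℝ j (h p.1) p.2) (univ ×ˢ V)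

theorem JointContDiffOn.continuousOn_uncurry {k : ℕ} {h : T → E → F} {V : Set E}
    (H : JointContDiffOn k h V) : ContinuousOn (fun p : T × E => h p.1 p.2) (univ ×ˢ V) := by
  have := (continuousMultilinearCurryFin0 ℝ E F).continuous.comp_continuousOn
    (H.continuousOn 0 (Nat.zero_le _))
  refine this.congr fun p _ => ?_
  simp [iteratedFDeriv_zero_eq_comp]

theorem JointContDiffOn.of_le {k l : ℕ} {h : T → E → F} {V : Set E}
    (H : JointContDiffOn k h V) (hl : l ≤ k) : JointContDiffOn l h V :=
  ⟨fun t => (H.contDiffOn t).of_le (by exact_mod_cast hl),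
    fun j hj => H.continuousOn j (hj.trans hl)⟩

theorem JointContDiffOn.fderiv {k : ℕ} {h : T → E → F} {V : Set E} (hV : IsOpen V)
    (H : JointContDiffOn (k + 1) h V) :
    JointContDiffOn k (fun t => fderiv ℝ (h t)) V := by
  refine ⟨fun t => (H.contDiffOn t).fderiv_of_isOpen hV (by norm_cast), fun j hj => ?_⟩
  have := (continuousMultilinearCurryRightEquiv' ℝ j E F).continuous.comp_continuousOn
    (H.continuousOn (j + 1) (by omega))
  refine this.congr fun p _ => ?_
  simp [iteratedFDeriv_succ_eq_comp_right]

/-- A family that does not depend on the parameter. -/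
theorem JointContDiffOn.const {k : ℕ} {f : E → F} {V : Set E} (hV : IsOpen V)
    (hf : ContDiffOn ℝ k f V) : JointContDiffOn k (fun _ : T => f) V := by
  refine ⟨fun _ => hf, fun j hj => ?_⟩
  have h1 : ContinuousOn (iteratedFDeriv ℝ j f) V :=
    (hf.continuousOn_iteratedFDerivWithin (by exact_mod_cast hj) hV.uniqueDiffOn).congr
      fun x hx => (iteratedFDerivWithin_of_isOpen j hV hx).symm
  exact h1.comp continuousOn_snd fun p hp => hp.2

open Classical in
/-- The superposition operator `γ ↦ (t ↦ h t (γ t))` on `C(T, E)`; the value is `0` when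
`t ↦ h t (γ t)` is not continuous. -/
def superposition (h : T → E → F) (γ : C(T, E)) : C(T, F) :=
  if hc : Continuous fun t => h t (γ t) then ⟨fun t => h t (γ t), hc⟩ else 0

omit [NormedSpace ℝ E] [NormedSpace ℝ F] in
theorem superposition_apply {h : T → E → F} {V : Set E}
    (hc : ContinuousOn (fun p : T × E => h p.1 p.2) (univ ×ˢ V)) {γ : C(T, E)}
    (hγ : ∀ t, γ t ∈ V) (t : T) : superposition h γ t = h t (γ t) := by
  have : Continuous fun t => h t (γ t) :=
    hc.comp_continuous (continuous_id.prodMk γ.continuous) fun t => ⟨mem_univ _, hγ t⟩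
  simp [superposition, this]

variable [CompactSpace T]

omit [NormedSpace ℝ E] in
theorem isOpen_setOf_forall_mem {V : Set E} (hV : IsOpen V) :
    IsOpen {γ : C(T, E) | ∀ t, γ t ∈ V} := by
  have := ContinuousMap.isOpen_setOfPred_mapsTo (X := T) (K := univ) isCompact_univ hV
  simpa [MapsTo] using this

omit [NormedSpace ℝ E] [NormedSpace ℝ F] in
theorem continuousOn_superposition {h : T → E → F} {V : Set E}
    (hc : ContinuousOn (fun p : T × E => h p.1 p.2) (univ ×ˢ V)) :
    ContinuousOn (superposition h) {γ : C(T, E) | ∀ t, γ t ∈ V} := by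
  refine ContinuousMap.continuousOn_of_continuousOn_uncurry _ ?_
  have h1 : ContinuousOn (fun q : C(T, E) × T => h q.2 (q.1 q.2))
      ({γ : C(T, E) | ∀ t, γ t ∈ V} ×ˢ univ) :=
    hc.comp (continuous_snd.prodMk ContinuousEval.continuous_eval).continuousOn
      fun q hq => ⟨mem_univ _, hq.1 q.2⟩
  exact h1.congr fun q hq => superposition_apply hc hq.1 q.2

/-- Pointwise application of a continuous family of linear maps, as a continuous linear map. -/
def pointwiseApply : C(T, E →L[ℝ] F) →L[ℝ] C(T, E) →L[ℝ] C(T, F) :=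
  LinearMap.mkContinuous₂
    (LinearMap.mk₂ ℝ (fun (A : C(T, E →L[ℝ] F)) (η : C(T, E)) =>
        (⟨fun t => A t (η t), A.continuous.clm_apply η.continuous⟩ : C(T, F)))
      (fun _ _ _ => by ext; simp) (fun _ _ _ => by ext; simp)
      (fun _ _ _ => by ext; simp) (fun _ _ _ => by ext; simp))
    1 (fun A η => by
      rw [ContinuousMap.norm_le _ (by positivity)]
      intro t
      simp only [LinearMap.mk₂_apply, ContinuousMap.coe_mk, one_mul]
      exact ((A t).le_opNorm _).trans
        (mul_le_mul (A.norm_coe_le_norm t) (η.norm_coe_le_norm t) (norm_nonneg _)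
          (norm_nonneg A)))

@[simp]
theorem pointwiseApply_apply (A : C(T, E →L[ℝ] F)) (η : C(T, E)) (t : T) :
    pointwiseApply A η t = A t (η t) := rfl

theorem hasFDerivAt_superposition {h : T → E → F} {V : Set E} (hV : IsOpen V)
    (H : JointContDiffOn 1 h V) {γ : C(T, E)} (hγ : ∀ t, γ t ∈ V) :
    HasFDerivAt (superposition h)
      (pointwiseApply (superposition (fun t => fderiv ℝ (h t)) γ)) γ := by
  have H' := (JointContDiffOn.fderiv hV H).continuousOn_uncurry
  have hO := isOpen_setOf_forall_mem (T := T) hV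
  rw [hasFDerivAt_iff_isLittleO_nhds_zero, Asymptotics.isLittleO_iff]
  intro ε hε
  have hcont : ContinuousAt (superposition (fun t => fderiv ℝ (h t))) γ :=
    (continuousOn_superposition H').continuousAt (hO.mem_nhds hγ)
  have hev := (Filter.eventually_mem_set.2 (hO.mem_nhds hγ)).and
    (Metric.tendsto_nhds.1 hcont ε hε)
  obtain ⟨δ, hδ, hball⟩ := Metric.eventually_nhds_iff_ball.1 hev
  have h0 : ∀ᶠ η : C(T, E) in 𝓝 0, η ∈ Metric.ball 0 δ := Metric.ball_mem_nhds _ hδ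
  filter_upwards [h0] with η hη
  have hη' : ‖η‖ < δ := by simpa using hη
  rw [ContinuousMap.norm_le _ (by positivity)]
  intro t
  have hmem : ∀ θ ∈ Icc (0 : ℝ) 1, γ + θ • η ∈ Metric.ball γ δ := fun θ hθ => by
    rw [mem_ball_iff_norm, add_sub_cancel_left, norm_smul, Real.norm_of_nonneg hθ.1]
    nlinarith [hθ.2, norm_nonneg η]
  have hγη : ∀ s, (γ + η) s ∈ V := by
    simpa using (hball _ (hmem 1 (by simp))).1
  simp only [ContinuousMap.sub_apply, superposition_apply H.continuousOn_uncurry hγ,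
    superposition_apply H.continuousOn_uncurry hγη, pointwiseApply_apply,
    superposition_apply (h := fun t => fderiv ℝ (h t)) H' hγ]
  have hseg : ∀ z ∈ segment ℝ (γ t) ((γ + η) t), z ∈ V ∧
      ‖fderiv ℝ (h t) z - fderiv ℝ (h t) (γ t)‖ ≤ ε := by
    intro z hz
    rw [segment_eq_image'] at hz
    obtain ⟨θ, hθ, rfl⟩ := hz
    obtain ⟨h1, h2⟩ := hball _ (hmem θ hθ)
    have hz : γ t + θ • ((γ + η) t - γ t) = (γ + θ • η) t := by simp
    beta_reduce
    rw [hz]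
    refine ⟨h1 t, ?_⟩
    have := (ContinuousMap.dist_apply_le_dist t).trans h2.le
    rwa [superposition_apply (h := fun t => fderiv ℝ (h t)) H' hγ,
      superposition_apply (h := fun t => fderiv ℝ (h t)) H' h1, dist_eq_norm] at this
  have := (convex_segment (γ t) ((γ + η) t)).norm_image_sub_le_of_norm_hasFDerivWithin_le'
    (f := h t) (f' := fderiv ℝ (h t)) (φ := fderiv ℝ (h t) (γ t)) (C := ε)
    (fun z hz => (((H.contDiffOn t).differentiableOn (by norm_num)).differentiableAt
      (hV.mem_nhds (hseg z hz).1)).hasFDerivAt.hasFDerivWithinAt)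
    (fun z hz => (hseg z hz).2) (left_mem_segment _ _ _) (right_mem_segment _ _ _)
  simp only [ContinuousMap.add_apply, add_sub_cancel_left] at this
  refine this.trans ?_
  gcongr
  exact η.norm_coe_le_norm t

/-- Superposition by a `C^k` family is a `C^k` operator on spaces of continuous functions. -/
theorem contDiffOn_superposition {k : ℕ} {h : T → E → F} {V : Set E} (hV : IsOpen V)
    (H : JointContDiffOn k h V) :
    ContDiffOn ℝ k (superposition h) {γ : C(T, E) | ∀ t, γ t ∈ V} := by
  have hO := isOpen_setOf_forall_mem (T := T) hV
  induction k generalizing F with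
  | zero => simpa [contDiffOn_zero] using continuousOn_superposition H.continuousOn_uncurry
  | succ k ih =>
    have hd : ∀ γ ∈ {γ : C(T, E) | ∀ t, γ t ∈ V}, _ := fun γ hγ =>
      hasFDerivAt_superposition hV (H.of_le (by omega)) hγ
    push_cast
    rw [contDiffOn_succ_iff_fderiv_of_isOpen hO]
    refine ⟨fun γ hγ => (hd γ hγ).differentiableAt.differentiableWithinAt, by simp, ?_⟩
    refine ContDiffOn.congr ?_ fun γ hγ => (hd γ hγ).fderiv
    exact pointwiseApply.contDiff.comp_contDiffOn (ih (JointContDiffOn.fderiv hV H))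

end Superposition

/-! ### Primitives depending on a parameter -/

section Primitive

universe u

variable {F : Type u} [NormedAddCommGroup F] [NormedSpace ℝ F]

omit [NormedSpace ℝ F] in
theorem continuous_comp_projIcc (γ : C(unitInterval, F)) :
    Continuous fun θ : ℝ => γ (projIcc 0 1 zero_le_one θ) :=
  γ.continuous.comp continuous_projIcc

/-- The primitive `t ↦ ∫_0^t γ` of a continuous function on `[0, 1]`, as a continuous linear
operator. -/
def primitive : C(unitInterval, F) →L[ℝ] C(unitInterval, F) :=
  LinearMap.mkContinuous
    { toFun := fun γ => ⟨fun t => ∫ θ in (0 : ℝ)..t, γ (projIcc 0 1 zero_le_one θ),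
        (intervalIntegral.continuous_primitive
          (fun _ _ => (continuous_comp_projIcc γ).intervalIntegrable _ _) 0).comp
          continuous_subtype_val⟩
      map_add' := fun γ η => by
        ext t
        simp only [ContinuousMap.add_apply, ContinuousMap.coe_mk]
        exact intervalIntegral.integral_add
          ((continuous_comp_projIcc γ).intervalIntegrable _ _)
          ((continuous_comp_projIcc η).intervalIntegrable _ _)
      map_smul' := fun c γ => by
        ext t
        simp }
    1 (fun γ => by
      rw [ContinuousMap.norm_le _ (by positivity)]
      intro t
      refine (intervalIntegral.norm_integral_le_of_norm_le_const (C := ‖γ‖)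
        fun θ _ => γ.norm_coe_le_norm _).trans ?_
      have : |(t : ℝ) - 0| ≤ 1 := by
        rw [sub_zero, abs_of_nonneg t.2.1]; exact t.2.2
      nlinarith [norm_nonneg γ])

theorem primitive_apply (γ : C(unitInterval, F)) (t : unitInterval) :
    primitive γ t = ∫ θ in (0 : ℝ)..t, γ (projIcc 0 1 zero_le_one θ) := rfl

/-- The primitive of a function given by an expression valid on `[0, 1]`. -/
theorem primitive_apply_eq {γ : C(unitInterval, F)} {f : ℝ → F}
    (h : ∀ t : unitInterval, γ t = f t) (t : unitInterval) :
    primitive γ t = ∫ θ in (0 : ℝ)..t, f θ := by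
  rw [primitive_apply]
  refine intervalIntegral.integral_congr fun θ hθ => ?_
  rw [uIcc_of_le t.2.1] at hθ
  have hθ' : θ ∈ Icc (0 : ℝ) 1 := ⟨hθ.1, hθ.2.trans t.2.2⟩
  rw [h, projIcc_of_mem _ hθ']

/-- The map sending `(s, ξ)` to the path `t ↦ (t s, ξ)`, `0 ≤ t ≤ 1`. -/
def rayPath (Ξ : Type u) [NormedAddCommGroup Ξ] [NormedSpace ℝ Ξ] :
    ℝ × Ξ →L[ℝ] C(unitInterval, ℝ × Ξ) :=
  LinearMap.mkContinuous
    { toFun := fun p => ⟨fun t => ((t : ℝ) * p.1, p.2), by fun_prop⟩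
      map_add' := fun p q => by ext t <;> simp [mul_add]
      map_smul' := fun c p => by ext t <;> simp [mul_left_comm] }
    1 (fun p => by
      rw [ContinuousMap.norm_le _ (by positivity)]
      intro t
      simp only [LinearMap.coe_mk, AddHom.coe_mk, ContinuousMap.coe_mk, one_mul, Prod.norm_def]
      refine max_le_max ?_ le_rfl
      rw [norm_mul, Real.norm_of_nonneg t.2.1]
      exact mul_le_of_le_one_left (norm_nonneg _) t.2.2)

/-- The integral `∫_0^s f(r, ξ) dr` of a function of class `C^k` is of class `C^k` in `(s, ξ)`:
it is `s ∫_0^1 f(t s, ξ) dt`, a superposition operator followed by a linear one. -/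
theorem contDiffOn_integral_fst {Ξ : Type u} [NormedAddCommGroup Ξ] [NormedSpace ℝ Ξ]
    {k : ℕ} {f : ℝ × Ξ → F} {V : Set (ℝ × Ξ)} (hV : IsOpen V) (hf : ContDiffOn ℝ k f V)
    (hray : ∀ p ∈ V, ∀ t ∈ Icc (0 : ℝ) 1, (t * p.1, p.2) ∈ V) :
    ContDiffOn ℝ k (fun p => ∫ r in (0 : ℝ)..p.1, f (r, p.2)) V := by
  have H : JointContDiffOn k (fun _ : unitInterval => f) V := .const hV hf
  have hmaps : ∀ p ∈ V, ∀ t, rayPath Ξ p t ∈ V := fun p hp t => hray p hp t t.2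
  have h1 : ContDiffOn ℝ k
      (fun p => superposition (fun _ : unitInterval => f) (rayPath Ξ p)) V :=
    (contDiffOn_superposition hV H).comp (rayPath Ξ).contDiff.contDiffOn hmaps
  have h2 : ContDiffOn ℝ k (fun p : ℝ × Ξ => p.1 • ContinuousMap.evalCLM ℝ (1 : unitInterval)
      (primitive (superposition (fun _ : unitInterval => f) (rayPath Ξ p)))) V :=
    contDiff_fst.contDiffOn.smul
      (((ContinuousMap.evalCLM ℝ (1 : unitInterval)).comp
        (primitive (F := F))).contDiff.comp_contDiffOn h1)
  refine h2.congr fun p hp => ?_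
  have : ∀ t : unitInterval, superposition (fun _ : unitInterval => f) (rayPath Ξ p) t =
      (fun θ : ℝ => f (θ * p.1, p.2)) t := fun t =>
    superposition_apply H.continuousOn_uncurry (hmaps p hp) t
  rw [ContinuousMap.evalCLM_apply, primitive_apply_eq (f := fun θ => f (θ * p.1, p.2)) this]
  simp [intervalIntegral.smul_integral_comp_mul_right (fun r => f (r, p.2))]

end Primitive

/-! ### The local flow of a vector field of class `C^k` -/

section LocalFlow

universe u

variable {E : Type u} [NormedAddCommGroup E] [NormedSpace ℝ E]

/-- The map `(x, τ, γ) ↦ γ - x - τ ∫_0^· a(γ)`, whose zeros are the paths `γ(t) = y(τ t)`,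
`0 ≤ t ≤ 1`, for the solutions `y` of `y' = a(y)`, `y(0) = x`. -/
def flowEquation (a : E → E) (v : (E × ℝ) × C(unitInterval, E)) : C(unitInterval, E) :=
  v.2 - ContinuousLinearMap.const ℝ unitInterval v.1.1 -
    v.1.2 • primitive (superposition (fun _ : unitInterval => a) v.2)

theorem contDiffAt_flowEquation {a : E → E} {U : Set E} (hU : IsOpen U) {k : ℕ}
    (ha : ContDiffOn ℝ k a U) {v : (E × ℝ) × C(unitInterval, E)} (hv : ∀ t, v.2 t ∈ U) :
    ContDiffAt ℝ k (flowEquation a) v := by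
  have h1 : ContDiffAt ℝ k (superposition (fun _ : unitInterval => a)) v.2 :=
    (contDiffOn_superposition hU (.const hU ha)).contDiffAt
      ((isOpen_setOf_forall_mem hU).mem_nhds hv)
  have h2 : ContDiffAt ℝ k (fun v : (E × ℝ) × C(unitInterval, E) =>
      primitive (superposition (fun _ : unitInterval => a) v.2)) v :=
    (primitive (F := E)).contDiff.contDiffAt.comp v (h1.comp v contDiffAt_snd)
  have h3 : ContDiffAt ℝ k (fun v : (E × ℝ) × C(unitInterval, E) =>
      ContinuousLinearMap.const ℝ unitInterval v.1.1) v :=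
    (ContinuousLinearMap.const ℝ unitInterval).contDiff.contDiffAt.comp v
      (contDiffAt_fst.comp v contDiffAt_fst)
  exact (contDiffAt_snd.sub h3).sub (((contDiffAt_snd (𝕜 := ℝ)).comp v contDiffAt_fst).smul h2)

/-- At `τ = 0` the derivative of `flowEquation` in `γ` is the identity. -/
theorem fderiv_flowEquation_comp_inr {a : E → E} {x : E} {γ : C(unitInterval, E)}
    (hd : DifferentiableAt ℝ (flowEquation a) ((x, 0), γ)) :
    fderiv ℝ (flowEquation a) ((x, 0), γ) ∘L .inr ℝ (E × ℝ) C(unitInterval, E) =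
      ContinuousLinearMap.id ℝ _ := by
  have h1 := hd.hasFDerivAt.comp γ (hasFDerivAt_prodMk_right (𝕜 := ℝ) (x, (0 : ℝ)) γ)
  have h2 : HasFDerivAt (flowEquation a ∘ fun γ => ((x, (0 : ℝ)), γ))
      (ContinuousLinearMap.id ℝ _) γ := by
    have : (flowEquation a ∘ fun γ => ((x, (0 : ℝ)), γ)) =
        fun γ => γ - ContinuousLinearMap.const ℝ unitInterval x := by
      ext γ; simp [flowEquation]
    rw [this]
    exact (hasFDerivAt_id γ).sub_const _
  exact h1.unique h2

variable [CompleteSpace E]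

/-- Solutions of `y' = a(y)` that depend continuously on `(y(0), t)` depend on it in a `C^k` way if
`a` is of class `C^k`, since the rescaled paths `t ↦ y(τ t)` are the solution of `flowEquation`
furnished by the implicit function theorem. -/
theorem contDiffAt_of_hasDerivAt {a : E → E} {U : Set E} (hU : IsOpen U) {k : ℕ} (hk : k ≠ 0)
    (ha : ContDiffOn ℝ k a U) {x₀ : E} (hx₀ : x₀ ∈ U) {α : E × ℝ → E} {W : Set E}
    (hW : W ∈ 𝓝 x₀) {ε : ℝ} (hε : 0 < ε) (hα : ContinuousOn α (W ×ˢ Ioo (-ε) ε))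
    (hα0 : ∀ x ∈ W, α (x, 0) = x)
    (hd : ∀ x ∈ W, ∀ t ∈ Ioo (-ε) ε, HasDerivAt (fun t => α (x, t)) (a (α (x, t))) t) :
    ContDiffAt ℝ k α (x₀, 0) := by
  have hmem : ∀ p ∈ W ×ˢ Ioo (-ε) ε, ∀ t ∈ Icc (0 : ℝ) 1,
      (p.1, t * p.2) ∈ W ×ˢ Ioo (-ε) ε := by
    rintro ⟨x, τ⟩ ⟨hx, hτ⟩ t ht
    refine ⟨hx, ?_⟩
    have : |t * τ| < ε := by
      rw [abs_mul, abs_of_nonneg ht.1]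
      exact (mul_le_of_le_one_left (abs_nonneg _) ht.2).trans_lt (abs_lt.2 hτ)
    exact abs_lt.1 this
  have hnhds : W ×ˢ Ioo (-ε) ε ∈ 𝓝 (x₀, (0 : ℝ)) :=
    prod_mem_nhds hW (Ioo_mem_nhds (by linarith) hε)
  -- the path `t ↦ α (x, t τ)` as an element of `C([0, 1], E)`
  set h : unitInterval → E × ℝ → E := fun t p => α (p.1, t * p.2) with hh
  have hcont : ContinuousOn (fun p : unitInterval × (E × ℝ) => h p.1 p.2)
      (univ ×ˢ (W ×ˢ Ioo (-ε) ε)) :=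
    hα.comp (by fun_prop) fun p hp => hmem p.2 hp.2 p.1 p.1.2
  set c : E × ℝ → C(unitInterval, E) := fun p =>
    superposition h (ContinuousLinearMap.const ℝ unitInterval p) with hc
  have hc_apply : ∀ p ∈ W ×ˢ Ioo (-ε) ε, ∀ t, c p t = α (p.1, t * p.2) := fun p hp t =>
    superposition_apply (γ := ContinuousLinearMap.const ℝ unitInterval p) hcont (fun _ => hp) t
  have hc_cont : ContinuousAt c (x₀, 0) :=
    ((continuousOn_superposition hcont).comp
      (ContinuousLinearMap.const ℝ unitInterval).continuous.continuousOn
      (fun p hp t => hp)).continuousAt hnhds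
  set γ₀ : C(unitInterval, E) := ContinuousLinearMap.const ℝ unitInterval x₀ with hγ₀
  have hc0 : c (x₀, 0) = γ₀ := by
    ext t
    rw [hc_apply _ (mem_of_mem_nhds hnhds)]
    simp [hα0 x₀ (mem_of_mem_nhds hW), hγ₀]
  have hsol : ∀ᶠ p in 𝓝 (x₀, (0 : ℝ)), flowEquation a (p, c p) = 0 := by
    have hcU : ∀ᶠ p in 𝓝 (x₀, (0 : ℝ)), c p ∈ {γ : C(unitInterval, E) | ∀ t, γ t ∈ U} := by
      refine hc_cont.eventually_mem ((isOpen_setOf_forall_mem hU).mem_nhds ?_)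
      rw [hc0]
      exact fun t => hx₀
    filter_upwards [hcU, hnhds] with p hpU hp
    ext t
    have h1 : ∀ s : unitInterval, superposition (fun _ : unitInterval => a) (c p) s =
        (fun θ : ℝ => a (α (p.1, θ * p.2))) s := fun s => by
      rw [superposition_apply (JointContDiffOn.const hU ha).continuousOn_uncurry hpU,
        hc_apply p hp]
    have hderiv : ∀ θ ∈ uIcc (0 : ℝ) t, HasDerivAt (fun θ => α (p.1, θ * p.2))
        (p.2 • a (α (p.1, θ * p.2))) θ := fun θ hθ => by
      rw [uIcc_of_le t.2.1] at hθ
      exact (hd p.1 hp.1 _ (hmem p hp θ ⟨hθ.1, hθ.2.trans t.2.2⟩).2).scomp θ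
        (hasDerivAt_mul_const p.2)
    have hint : IntervalIntegrable (fun θ => p.2 • a (α (p.1, θ * p.2)))
        MeasureTheory.volume 0 t := by
      refine ContinuousOn.intervalIntegrable ?_
      have hca : ContinuousOn (fun θ => a (α (p.1, θ * p.2))) (uIcc (0 : ℝ) t) := by
        refine ha.continuousOn.comp (fun θ hθ => (hderiv θ hθ).continuousAt.continuousWithinAt)
          fun θ hθ => ?_
        rw [uIcc_of_le t.2.1] at hθ
        have := hpU ⟨θ, hθ.1, hθ.2.trans t.2.2⟩
        rwa [hc_apply p hp] at this
      exact continuousOn_const.smul hca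
    have hFTC := intervalIntegral.integral_eq_sub_of_hasDerivAt hderiv hint
    rw [intervalIntegral.integral_smul] at hFTC
    have e1 : (flowEquation a (p, c p)) t = c p t - p.1 -
        p.2 • primitive (superposition (fun _ : unitInterval => a) (c p)) t := rfl
    rw [e1, primitive_apply_eq (f := fun θ => a (α (p.1, θ * p.2))) h1, hFTC, hc_apply p hp]
    simp [hα0 p.1 hp.1]
  have hcd : ContDiffAt ℝ k (flowEquation a) ((x₀, 0), γ₀) :=
    contDiffAt_flowEquation hU ha fun t => hx₀
  have hk' : ((k : ℕ∞) : WithTop ℕ∞) ≠ 0 := by exact_mod_cast hk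
  have hinv : (fderiv ℝ (flowEquation a) ((x₀, 0), γ₀) ∘L
      .inr ℝ (E × ℝ) C(unitInterval, E)).IsInvertible := by
    rw [fderiv_flowEquation_comp_inr (hcd.differentiableAt hk')]
    exact ⟨ContinuousLinearEquiv.refl ℝ _, rfl⟩
  have hev := hcd.eventually_apply_eq_iff_implicitFunction hk' hinv
  have ht : Tendsto (fun p => (p, c p)) (𝓝 (x₀, (0 : ℝ))) (𝓝 ((x₀, 0), γ₀)) := by
    rw [← hc0]
    exact (continuousAt_id.prodMk hc_cont)
  have hzero : flowEquation a ((x₀, 0), γ₀) = 0 := by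
    rw [← hc0]; exact hsol.self_of_nhds
  have heq : α =ᶠ[𝓝 (x₀, 0)]
      fun p => ContinuousMap.evalCLM ℝ (1 : unitInterval) (hcd.implicitFunction hk' hinv p) := by
    filter_upwards [ht.eventually hev, hsol, hnhds] with p h1 h2 hp
    rw [h1.1 (h2.trans hzero.symm), ContinuousMap.evalCLM_apply, hc_apply p hp]
    simp
  exact ((ContinuousMap.evalCLM (M := E) ℝ (1 : unitInterval)).contDiff.contDiffAt.comp _
    (hcd.contDiffAt_implicitFunction hk' hinv)).congr_of_eventuallyEq heq

/-- A vector field of class `C^k`, `k ≥ 1`, has near each point a local flow of class `C^k`. -/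
theorem exists_contDiffOn_localFlow {a : E → E} {U : Set E} (hU : IsOpen U) {k : ℕ} (hk : k ≠ 0)
    (ha : ContDiffOn ℝ k a U) {x₀ : E} (hx₀ : x₀ ∈ U) :
    ∃ (φ : E × ℝ → E) (W : Set E) (ε : ℝ), IsOpen W ∧ x₀ ∈ W ∧ 0 < ε ∧
      ContDiffOn ℝ k φ (W ×ˢ Ioo (-ε) ε) ∧ (∀ x ∈ W, φ (x, 0) = x) ∧
      ∀ x ∈ W, ∀ t ∈ Ioo (-ε) ε, φ (x, t) ∈ U ∧
        HasDerivAt (fun t => φ (x, t)) (a (φ (x, t))) t := by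
  have ha1 : ContDiffAt ℝ 1 a x₀ := (ha.contDiffAt (hU.mem_nhds hx₀)).of_le
    (by exact_mod_cast Nat.one_le_iff_ne_zero.2 hk)
  obtain ⟨ε, hε, A, r, L, K, hr, hpl⟩ := IsPicardLindelof.of_contDiffAt_one ha1
  obtain ⟨α, hα, hcont⟩ := (hpl 0).exists_forall_mem_closedBall_eq_hasDerivWithinAt_continuousOn
  simp only [zero_sub, zero_add] at hα hcont
  have hball : Metric.closedBall x₀ (r : ℝ) ∈ 𝓝 x₀ := Metric.closedBall_mem_nhds _ hr
  have hd : ∀ x ∈ Metric.closedBall x₀ (r : ℝ), ∀ t ∈ Ioo (-ε) ε,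
      HasDerivAt (fun t => α (x, t)) (a (α (x, t))) t := fun x hx t ht =>
    ((hα x hx).2 t (Ioo_subset_Icc_self ht)).hasDerivAt (Icc_mem_nhds ht.1 ht.2)
  have hC : ContDiffAt ℝ k α (x₀, 0) := contDiffAt_of_hasDerivAt hU hk ha hx₀ hball hε
    (hcont.mono (prod_mono le_rfl Ioo_subset_Icc_self)) (fun x hx => (hα x hx).1) hd
  have hev : ∀ᶠ p in 𝓝 (x₀, (0 : ℝ)), ContDiffAt ℝ k α p ∧ α p ∈ U ∧
      p.1 ∈ Metric.closedBall x₀ (r : ℝ) ∧ p.2 ∈ Ioo (-ε) ε := by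
    refine (hC.eventually (by simp)).and ((hC.continuousAt.eventually_mem ?_).and
      ((continuousAt_fst.eventually_mem hball).and
        (continuousAt_snd.eventually_mem (Ioo_mem_nhds (by simpa) hε))))
    rw [(hα x₀ (mem_of_mem_nhds hball)).1]
    exact hU.mem_nhds hx₀
  rw [nhds_prod_eq] at hev
  obtain ⟨W', hW', I, hI, hprod⟩ := Filter.mem_prod_iff.1 hev
  obtain ⟨W, hWW', hWo, hxW⟩ := mem_nhds_iff.1 hW'
  obtain ⟨δ, hδ, hδI⟩ := Metric.mem_nhds_iff.1 hI
  rw [Real.ball_eq_Ioo, zero_sub, zero_add] at hδI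
  have key : ∀ x ∈ W, ∀ t ∈ Ioo (-δ) δ, _ := fun x hx t ht =>
    hprod (show (x, t) ∈ W' ×ˢ I from ⟨hWW' hx, hδI ht⟩)
  have h0 : (0 : ℝ) ∈ Ioo (-δ) δ := ⟨by linarith, hδ⟩
  refine ⟨α, W, δ, hWo, hxW, hδ, ?_, fun x hx => (hα x (key x hx 0 h0).2.2.1).1, ?_⟩
  · rintro ⟨x, t⟩ ⟨hx, ht⟩
    exact (key x hx t ht).1.contDiffWithinAt
  · intro x hx t ht
    exact ⟨(key x hx t ht).2.1, hd x (key x hx t ht).2.2.1 t (key x hx t ht).2.2.2⟩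

end LocalFlow

/-! ### Uniqueness of solutions and injective immersions -/

/-- Two solutions of `x' = a(x)` on an open interval that agree at one point agree everywhere. -/
theorem eqOn_of_hasDerivAt_of_eq {E : Type*} [NormedAddCommGroup E] [NormedSpace ℝ E] {a : E → E}
    {U : Set E} (hU : IsOpen U) (ha : ContDiffOn ℝ 1 a U) {I : Set ℝ} (hI : IsOpen I)
    (hIc : IsPreconnected I) {x y : ℝ → E} (hxU : ∀ t ∈ I, x t ∈ U)
    (hx : ∀ t ∈ I, HasDerivAt x (a (x t)) t) (hy : ∀ t ∈ I, HasDerivAt y (a (y t)) t)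
    {t₀ : ℝ} (ht₀ : t₀ ∈ I) (h0 : x t₀ = y t₀) : EqOn x y I := by
  suffices hsub : I ⊆ {t | x t = y t} ∩ I from fun t ht => (hsub ht).1
  refine hIc.subset_of_closure_inter_subset ?_ ⟨t₀, ht₀, h0, ht₀⟩ ?_
  · rw [isOpen_iff_mem_nhds]
    rintro t ⟨hxy, ht⟩
    have hxy : x t = y t := hxy
    obtain ⟨K, s, hs, hK⟩ :=
      (ha.contDiffAt (hU.mem_nhds (hxU t ht))).exists_lipschitzOnWith
    have hev : x =ᶠ[𝓝 t] y := by
      refine ODE_solution_unique_of_eventually (v := fun _ => a) (s := fun _ => s) (K := K)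
        (Eventually.of_forall fun _ => hK) ?_ ?_ hxy
      · filter_upwards [hI.mem_nhds ht, (hx t ht).continuousAt hs] with r hr hr'
        exact ⟨hx r hr, hr'⟩
      · filter_upwards [hI.mem_nhds ht, (hy t ht).continuousAt (hxy ▸ hs)] with r hr hr'
        exact ⟨hy r hr, hr'⟩
    exact inter_mem hev (hI.mem_nhds ht)
  · rintro t ⟨htc, ht⟩
    refine ⟨?_, ht⟩
    by_contra hne
    have hne' : ∀ᶠ r in 𝓝 t, x r ≠ y r :=
      ((hx t ht).continuousAt.ne_iff_eventually_ne (hy t ht).continuousAt).1 hne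
    obtain ⟨r, hr, hr'⟩ := mem_closure_iff_nhds.1 htc _ hne'
    exact hr hr'.1

/-- A function that vanishes at `0` and can only vanish with a positive derivative is nonzero at
positive times. -/
theorem ne_zero_of_deriv_pos_of_eq_zero {f f' : ℝ → ℝ} {s : ℝ} (hs : 0 < s) (h0 : f 0 = 0)
    (hf : ∀ t ∈ Icc 0 s, HasDerivAt f (f' t) t) (hpos : ∀ t ∈ Icc 0 s, f t = 0 → 0 < f' t) :
    f s ≠ 0 := by
  have hnonneg : ∀ t ∈ Icc 0 s, 0 ≤ f t := by
    intro t ht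
    exact image_le_of_deriv_right_lt_deriv_boundary' (f := fun _ => (0 : ℝ)) (f' := fun _ => 0)
      continuousOn_const (fun _ _ => hasDerivWithinAt_const _ _ _) h0.ge
      (fun t ht => (hf t ht).continuousAt.continuousWithinAt)
      (fun t ht => (hf t (Ico_subset_Icc_self ht)).hasDerivWithinAt)
      (fun t ht h => hpos t (Ico_subset_Icc_self ht) h.symm) ht
  intro hfs
  have hsmem : s ∈ Icc 0 s := ⟨hs.le, le_rfl⟩
  have hslope : ∀ᶠ t in 𝓝[<] s, 0 < slope f s t :=
    ((hasDerivAt_iff_tendsto_slope_left_right.1 (hf s hsmem)).1).eventually_const_lt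
      (hpos s hsmem hfs)
  obtain ⟨t, ht, ht0, hts⟩ := (hslope.and (Ioo_mem_nhdsLT hs)).exists
  have := hnonneg t ⟨ht0.le, hts.le⟩
  rw [slope_def_field, hfs, sub_zero] at ht
  exact absurd ht (not_lt.2 (div_nonpos_of_nonneg_of_nonpos this (by linarith)))

/-- An injective `C^k` map between open sets of a finite-dimensional space whose derivative is
everywhere injective is a diffeomorphism onto its image. -/
theorem isDiffeoOn_image {X : Type*} [NormedAddCommGroup X] [NormedSpace ℝ X]
    [FiniteDimensional ℝ X] {k : ℕ} (hk : k ≠ 0) {f : X → X} {s : Set X} (hs : IsOpen s)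
    (hf : ContDiffOn ℝ k f s) (hinj : InjOn f s)
    (hd : ∀ x ∈ s, Function.Injective (fderiv ℝ f x)) : IsDiffeoOn k f s (f '' s) := by
  have := FiniteDimensional.complete ℝ X
  have hk' : ((k : ℕ∞) : WithTop ℕ∞) ≠ 0 := by exact_mod_cast hk
  have hfx : ∀ x ∈ s, ContDiffAt ℝ k f x := fun x hx => hf.contDiffAt (hs.mem_nhds hx)
  have hequiv : ∀ x ∈ s, ∃ e : X ≃L[ℝ] X, HasFDerivAt f (e : X →L[ℝ] X) x := fun x hx => by
    refine ⟨(LinearEquiv.ofInjectiveEndo (fderiv ℝ f x : X →ₗ[ℝ] X)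
      (hd x hx)).toContinuousLinearEquiv, ?_⟩
    convert ((hfx x hx).differentiableAt hk').hasFDerivAt
    ext v
    rfl
  refine ⟨hs, ?_, hinj.bijOn_image, hf, Function.invFunOn f s, hinj.bijOn_image.invOn_invFunOn, ?_⟩
  · rw [isOpen_iff_mem_nhds]
    rintro _ ⟨x, hx, rfl⟩
    obtain ⟨e, he⟩ := hequiv x hx
    rw [← ((hfx x hx).hasStrictFDerivAt' he hk').map_nhds_eq_of_equiv]
    exact image_mem_map (hs.mem_nhds hx)
  · rintro _ ⟨x, hx, rfl⟩
    obtain ⟨e, he⟩ := hequiv x hx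
    have hst := (hfx x hx).hasStrictFDerivAt' he hk'
    refine ContDiffAt.contDiffWithinAt ?_
    refine ((hfx x hx).to_localInverse he hk').congr_of_eventuallyEq ?_
    have hmem : ∀ᶠ y in 𝓝 (f x), hst.localInverse f e x y ∈ s := by
      refine hst.localInverse_continuousAt.eventually_mem ?_
      rw [hst.localInverse_apply_image]
      exact hs.mem_nhds hx
    filter_upwards [hmem, hst.eventually_right_inverse] with y hy1 hy2
    have hy : y ∈ f '' s := ⟨_, hy1, hy2⟩
    exact hinj (Function.invFunOn_mem hy) hy1 ((Function.invFunOn_eq hy).trans hy2.symm)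

/-! ### The flow is a diffeomorphism -/

section Flow

variable {d : ℕ} {a : Space d → Space d} {U : Set (Space d)} {l : ℝ}

theorem isOpen_strip (d : ℕ) (l : ℝ) : IsOpen (strip d l) := isOpen_Ioi.prod isOpen_univ

theorem mem_strip {p : ℝ × Transverse d} : p ∈ strip d l ↔ -l < p.1 := by
  simp [strip]

theorem zero_mem_strip (hl : 0 < l) (ξ : Transverse d) : ((0, ξ) : ℝ × Transverse d) ∈ strip d l :=
  mem_strip.2 (by simpa using hl)

variable (hU : IsOpen U) (ha : ContDiffOn ℝ 1 a U) (hl : 0 < l)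
  (hΩ : strip d l ⊆ flowDomain a U)

include hU ha hl hΩ

theorem flow_zero (ξ : Transverse d) : flow a U (0, ξ) = (0, ξ) :=
  (flow_isCharacteristic hU ha (hΩ (zero_mem_strip hl ξ))).init

theorem flow_mem {p : ℝ × Transverse d} (hp : p ∈ strip d l) : flow a U p ∈ U :=
  (flow_isCharacteristic hU ha (hΩ (zero_mem_strip hl p.2))).mem p.1 (hΩ hp)

theorem hasDerivAt_flow {s : ℝ} {ξ : Transverse d} (hs : -l < s) :
    HasDerivAt (fun s => flow a U (s, ξ)) (a (flow a U (s, ξ))) s :=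
  (flow_isCharacteristic hU ha (hΩ (zero_mem_strip hl ξ))).hasDerivAt s (hΩ (mem_strip.2 hs))

/-- The flow is injective: a trajectory crosses `{x₁ = 0}` only with increasing `x₁`, hence at most
once. -/
theorem injOn_flow (ha_in : ∀ ξ : Transverse d, 0 < (a (0, ξ)).1) :
    InjOn (flow a U) (strip d l) := by
  suffices key : ∀ s t : ℝ, ∀ ξ η : Transverse d, -l < t → t ≤ s →
      flow a U (s, ξ) = flow a U (t, η) → (s, ξ) = (t, η) by
    rintro ⟨s, ξ⟩ hs ⟨t, η⟩ ht h
    rw [mem_strip] at hs ht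
    rcases le_total t s with hts | hst
    · exact key s t ξ η ht hts h
    · exact (key t s η ξ hs hst h.symm).symm
  intro s t ξ η ht hts h
  -- both solutions agree after a time shift, so the one from `(0, ξ)` meets `{x₁ = 0}` at `s - t`
  have heq : EqOn (fun r => flow a U (s - t + r, ξ)) (fun r => flow a U (r, η)) (Ioi (-l)) := by
    refine eqOn_of_hasDerivAt_of_eq hU ha isOpen_Ioi isPreconnected_Ioi ?_ ?_ ?_
      (show t ∈ Ioi (-l) from ht) (by simpa using h)
    · intro r hr
      refine flow_mem hU ha hl hΩ (mem_strip.2 ?_)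
      simp only [mem_Ioi] at hr ⊢
      linarith
    · intro r hr
      simp only [mem_Ioi] at hr
      exact HasDerivAt.comp_const_add (s - t) r
        (hasDerivAt_flow (s := s - t + r) (ξ := ξ) hU ha hl hΩ (by linarith))
    · intro r hr
      exact hasDerivAt_flow hU ha hl hΩ hr
  have h0 : flow a U (s - t, ξ) = (0, η) := by
    have := heq (show (0 : ℝ) ∈ Ioi (-l) by simpa using hl)
    simpa [flow_zero hU ha hl hΩ] using this
  have hst : s = t := by
    by_contra hne
    have hpos : 0 < s - t := sub_pos.2 (lt_of_le_of_ne hts (Ne.symm hne))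
    refine ne_zero_of_deriv_pos_of_eq_zero (f := fun r => (flow a U (r, ξ)).1)
      (f' := fun r => (a (flow a U (r, ξ))).1) hpos ?_ ?_ ?_ ?_
    · simp [flow_zero hU ha hl hΩ]
    · intro r hr
      exact (hasFDerivAt_fst (𝕜 := ℝ)).comp_hasDerivAt r
        (hasDerivAt_flow hU ha hl hΩ (by linarith [hr.1]))
    · intro r _ hr
      have : flow a U (r, ξ) = (0, (flow a U (r, ξ)).2) := Prod.ext hr rfl
      rw [this]
      exact ha_in _
    · simp [h0]
  subst hst
  rw [sub_self, flow_zero hU ha hl hΩ] at h0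
  rw [show ξ = η from congrArg Prod.snd h0]

/-- Over a point where a local flow `φ` is defined, the flow is given by `φ`. -/
theorem flow_eq_localFlow {φ : Space d × ℝ → Space d} {W : Set (Space d)} {ε : ℝ}
    (hφ0 : ∀ x ∈ W, φ (x, 0) = x)
    (hφ : ∀ x ∈ W, ∀ t ∈ Ioo (-ε) ε, HasDerivAt (fun t => φ (x, t)) (a (φ (x, t))) t)
    {s r : ℝ} {ξ : Transverse d} (hs : -l < s) (hr : -l < r) (hsr : |r - s| < ε)
    (hW : flow a U (s, ξ) ∈ W) : flow a U (r, ξ) = φ (flow a U (s, ξ), r - s) := by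
  have heq : EqOn (fun r => flow a U (r, ξ)) (fun r => φ (flow a U (s, ξ), r - s))
      (Ioo (s - ε) (s + ε) ∩ Ioi (-l)) := by
    refine eqOn_of_hasDerivAt_of_eq hU ha (isOpen_Ioo.inter isOpen_Ioi)
      (ordConnected_Ioo.inter ordConnected_Ioi).isPreconnected ?_ ?_ ?_
      (t₀ := s) ?_ (by simp [hφ0 _ hW])
    · exact fun t ht => flow_mem hU ha hl hΩ (mem_strip.2 ht.2)
    · exact fun t ht => hasDerivAt_flow hU ha hl hΩ ht.2
    · intro t ht
      exact HasDerivAt.comp_sub_const t s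
        (hφ _ hW (t - s) ⟨by linarith [ht.1.1], by linarith [ht.1.2]⟩)
    · have := (abs_nonneg _).trans_lt hsr
      exact ⟨⟨by linarith, by linarith⟩, hs⟩
  have := abs_lt.1 hsr
  exact heq ⟨⟨by linarith, by linarith⟩, hr⟩

theorem eventually_flow_eq_localFlow {φ : Space d × ℝ → Space d} {W : Set (Space d)} {ε : ℝ}
    (hW : IsOpen W) (hφ0 : ∀ x ∈ W, φ (x, 0) = x)
    (hφ : ∀ x ∈ W, ∀ t ∈ Ioo (-ε) ε, HasDerivAt (fun t => φ (x, t)) (a (φ (x, t))) t)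
    {s r : ℝ} {ξ : Transverse d} (hs : -l < s) (hr : -l < r) (hsr : |r - s| < ε)
    (hWs : flow a U (s, ξ) ∈ W) (hc : ContinuousAt (fun ξ => flow a U (s, ξ)) ξ) :
    flow a U =ᶠ[𝓝 (r, ξ)] fun p => φ (flow a U (s, p.2), p.1 - s) := by
  have h1 : ∀ᶠ p : ℝ × Transverse d in 𝓝 (r, ξ), flow a U (s, p.2) ∈ W :=
    ContinuousAt.eventually_mem (f := fun p : ℝ × Transverse d => flow a U (s, p.2))
      (ContinuousAt.comp (f := Prod.snd) (x := (r, ξ)) hc continuousAt_snd) (hW.mem_nhds hWs)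
  have h2 : ∀ᶠ p : ℝ × Transverse d in 𝓝 (r, ξ), -l < p.1 :=
    continuousAt_fst.eventually_const_lt hr
  have h3 : ∀ᶠ p : ℝ × Transverse d in 𝓝 (r, ξ), |p.1 - s| < ε :=
    Tendsto.eventually_lt_const hsr (ContinuousAt.tendsto (by fun_prop))
  filter_upwards [h1, h2, h3] with p h1 h2 h3
  exact flow_eq_localFlow hU ha hl hΩ hφ0 hφ hs h2 h3 h1

theorem contDiffAt_flow_of_localFlow {φ : Space d × ℝ → Space d} {W : Set (Space d)} {ε : ℝ}
    {k : ℕ} (hW : IsOpen W) (hφC : ContDiffOn ℝ k φ (W ×ˢ Ioo (-ε) ε))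
    (hφ0 : ∀ x ∈ W, φ (x, 0) = x)
    (hφ : ∀ x ∈ W, ∀ t ∈ Ioo (-ε) ε, HasDerivAt (fun t => φ (x, t)) (a (φ (x, t))) t)
    {s r : ℝ} {ξ : Transverse d} (hs : -l < s) (hr : -l < r) (hsr : |r - s| < ε)
    (hWs : flow a U (s, ξ) ∈ W) (hc : ContDiffAt ℝ k (fun ξ => flow a U (s, ξ)) ξ) :
    ContDiffAt ℝ k (flow a U) (r, ξ) := by
  refine ContDiffAt.congr_of_eventuallyEq ?_
    (eventually_flow_eq_localFlow hU ha hl hΩ hW hφ0 hφ hs hr hsr hWs hc.continuousAt)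
  have h1 : ContDiffAt ℝ k φ (flow a U (s, ξ), r - s) :=
    hφC.contDiffAt ((hW.prod isOpen_Ioo).mem_nhds ⟨hWs, abs_lt.1 hsr⟩)
  have h2 : ContDiffAt ℝ k (fun p : ℝ × Transverse d => (flow a U (s, p.2), p.1 - s)) (r, ξ) :=
    ContDiffAt.prodMk (ContDiffAt.comp (r, ξ) hc contDiffAt_snd)
      (contDiffAt_fst.sub contDiffAt_const)
  exact h1.comp (r, ξ) h2

/-- At `s = 0` the derivative of the flow is `(σ, η) ↦ σ a(0, ξ) + (0, η)`, and `a₁(0, ξ) ≠ 0`. -/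
theorem fderiv_flow_zero_injective (ha_in : ∀ ξ : Transverse d, 0 < (a (0, ξ)).1)
    {ξ : Transverse d} (hd : DifferentiableAt ℝ (flow a U) (0, ξ)) :
    Function.Injective (fderiv ℝ (flow a U) (0, ξ)) := by
  have h1 : fderiv ℝ (flow a U) (0, ξ) (1, 0) = a (0, ξ) := by
    have e1 : HasDerivAt (fun s : ℝ => (s, ξ)) (1, 0) 0 :=
      (hasDerivAt_id 0).prodMk (hasDerivAt_const 0 ξ)
    have e2 := hd.hasFDerivAt.comp_hasDerivAt (0 : ℝ) e1
    have e3 := hasDerivAt_flow (s := 0) (ξ := ξ) hU ha hl hΩ (by linarith)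
    rw [flow_zero hU ha hl hΩ] at e3
    exact e2.unique e3
  have h2 : ∀ η, fderiv ℝ (flow a U) (0, ξ) (0, η) = (0, η) := by
    intro η
    have e1 := hd.hasFDerivAt.comp ξ (hasFDerivAt_prodMk_right (𝕜 := ℝ) (0 : ℝ) ξ)
    have e2 : HasFDerivAt (flow a U ∘ fun ξ => ((0 : ℝ), ξ))
        (ContinuousLinearMap.inr ℝ ℝ (Transverse d)) ξ := by
      have : (flow a U ∘ fun ξ => ((0 : ℝ), ξ)) = fun ξ => (0, ξ) :=
        funext fun ξ => flow_zero hU ha hl hΩ ξ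
      rw [this]
      exact hasFDerivAt_prodMk_right (𝕜 := ℝ) (0 : ℝ) ξ
    exact congrArg (fun L => L η) (e1.unique e2)
  rw [injective_iff_map_eq_zero]
  rintro ⟨σ, η⟩ h
  have hdec : ((σ, η) : ℝ × Transverse d) = σ • (1, 0) + (0, η) := by simp
  rw [hdec, map_add, map_smul, h1, h2] at h
  have hσ : σ = 0 := by
    have := congrArg Prod.fst h
    simpa [(ha_in ξ).ne'] using this
  subst hσ
  have hη : η = 0 := by simpa using congrArg Prod.snd h
  simp [hη]

/-- Regularity of the flow and injectivity of its derivative propagate along a trajectory, in both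
time directions, as far as a local flow reaches. -/
theorem contDiffAt_flow_and_injective {k : ℕ} (hk : k ≠ 0) (hak : ContDiffOn ℝ k a U)
    (ha_in : ∀ ξ : Transverse d, 0 < (a (0, ξ)).1) {p : ℝ × Transverse d} (hp : p ∈ strip d l) :
    ContDiffAt ℝ k (flow a U) p ∧ Function.Injective (fderiv ℝ (flow a U) p) := by
  obtain ⟨s, ξ⟩ := p
  have hk' : ((k : ℕ∞) : WithTop ℕ∞) ≠ 0 := by exact_mod_cast hk
  set G : ℝ → Prop := fun s => ContDiffAt ℝ k (flow a U) (s, ξ) ∧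
    Function.Injective (fderiv ℝ (flow a U) (s, ξ)) with hG
  have h00 : -l < 0 := by linarith
  -- propagation in a neighbourhood of each time
  have hstep : ∀ s₀, -l < s₀ → ∀ᶠ s in 𝓝 s₀, ∀ᶠ r in 𝓝 s₀, G s → G r := by
    intro s₀ hs₀
    obtain ⟨φ, W, ε, hW, hxW, hε, hφC, hφ0, hφ⟩ := exists_contDiffOn_localFlow hU hk hak
      (flow_mem hU ha hl hΩ (mem_strip.2 hs₀ : ((s₀, ξ) : ℝ × Transverse d) ∈ _))
    have hφ' : ∀ x ∈ W, ∀ t ∈ Ioo (-ε) ε, _ := fun x hx t ht => (hφ x hx t ht).2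
    have hnear : ∀ᶠ s in 𝓝 s₀, -l < s ∧ flow a U (s, ξ) ∈ W ∧ |s - s₀| < ε / 2 := by
      refine (eventually_gt_nhds hs₀).and (((hasDerivAt_flow hU ha hl hΩ
        hs₀).continuousAt.eventually_mem (hW.mem_nhds hxW)).and ?_)
      exact Metric.ball_mem_nhds s₀ (half_pos hε)
    filter_upwards [hnear] with s hs
    filter_upwards [hnear] with r hr hGs
    have hrs : |r - s| < ε := by
      have := abs_sub_le r s₀ s
      rw [abs_sub_comm s₀ s] at this
      linarith [hs.2.2, hr.2.2]
    have hCr : ContDiffAt ℝ k (flow a U) (r, ξ) :=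
      contDiffAt_flow_of_localFlow hU ha hl hΩ hW hφC hφ0 hφ' hs.1 hr.1 hrs hs.2.1
        (hGs.1.comp ξ (contDiffAt_const.prodMk contDiffAt_id))
    refine ⟨hCr, ?_⟩
    -- `Φ(s', η) = φ(Φ(s' + r - s, η), s - r)` near `(s, ξ)`
    have hev : flow a U =ᶠ[𝓝 (s, ξ)] fun p => φ (flow a U (p.1 + (r - s), p.2), s - r) := by
      have hshift : ContinuousAt (fun p : ℝ × Transverse d => (p.1 + (r - s), p.2)) (s, ξ) := by
        fun_prop
      have hcont : ContinuousAt
          (fun p : ℝ × Transverse d => flow a U (p.1 + (r - s), p.2)) (s, ξ) :=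
        ContinuousAt.comp' (f := fun p : ℝ × Transverse d => (p.1 + (r - s), p.2))
          (by simpa using hCr.continuousAt) hshift
      have h1 : ∀ᶠ p : ℝ × Transverse d in 𝓝 (s, ξ), flow a U (p.1 + (r - s), p.2) ∈ W :=
        hcont.eventually_mem (hW.mem_nhds (by simpa using hr.2.1))
      have h2 : ∀ᶠ p : ℝ × Transverse d in 𝓝 (s, ξ), -l < p.1 :=
        continuousAt_fst.eventually_const_lt hs.1
      have h3 : ∀ᶠ p : ℝ × Transverse d in 𝓝 (s, ξ), -l < p.1 + (r - s) :=
        Tendsto.eventually_const_lt (v := s + (r - s)) (by simpa using hr.1)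
          (ContinuousAt.tendsto (x := (s, ξ))
            (f := fun p : ℝ × Transverse d => p.1 + (r - s)) (by fun_prop))
      filter_upwards [h1, h2, h3] with p h1 h2 h3
      have := flow_eq_localFlow hU ha hl hΩ hφ0 hφ' (s := p.1 + (r - s)) (r := p.1) (ξ := p.2)
        h3 h2 (by simpa [abs_sub_comm] using hrs) h1
      rwa [show p.1 - (p.1 + (r - s)) = s - r by ring] at this
    have hdφ : DifferentiableAt ℝ (fun x => φ (x, s - r)) (flow a U (r, ξ)) := by
      have : ContDiffAt ℝ k φ (flow a U (r, ξ), s - r) :=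
        hφC.contDiffAt ((hW.prod isOpen_Ioo).mem_nhds
          ⟨hr.2.1, abs_lt.1 (by rwa [abs_sub_comm] at hrs)⟩)
      exact DifferentiableAt.comp (flow a U (r, ξ)) (f := fun x => (x, s - r))
        (this.differentiableAt hk') (by fun_prop)
    have hdshift : HasFDerivAt (fun p : ℝ × Transverse d => (p.1 + (r - s), p.2))
        (ContinuousLinearMap.id ℝ (ℝ × Transverse d)) (s, ξ) := by
      have := (hasFDerivAt_id (𝕜 := ℝ) ((s, ξ) : ℝ × Transverse d)).add_const (r - s, 0)
      exact this.congr_of_eventuallyEq (Eventually.of_forall fun p => by ext <;> simp)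
    have hcomp : HasFDerivAt (fun p : ℝ × Transverse d => flow a U (p.1 + (r - s), p.2))
        ((fderiv ℝ (flow a U) (r, ξ)).comp (ContinuousLinearMap.id ℝ (ℝ × Transverse d)))
        (s, ξ) := by
      have := (hCr.differentiableAt hk').hasFDerivAt
      exact HasFDerivAt.comp (s, ξ) (f := fun p : ℝ × Transverse d => (p.1 + (r - s), p.2))
        (by simpa using this) hdshift
    have hcomp2 := HasFDerivAt.comp (s, ξ)
      (f := fun p : ℝ × Transverse d => flow a U (p.1 + (r - s), p.2))
      (g := fun x => φ (x, s - r)) (by simpa using hdφ.hasFDerivAt) hcomp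
    have hfd := (hcomp2.congr_of_eventuallyEq hev).fderiv
    rw [injective_iff_map_eq_zero]
    intro v hv
    refine (injective_iff_map_eq_zero _).1 hGs.2 v ?_
    rw [hfd]
    simp [hv]
  have hG0 : G 0 := by
    obtain ⟨φ, W, ε, hW, hxW, hε, hφC, hφ0, hφ⟩ := exists_contDiffOn_localFlow hU hk hak
      (flow_mem hU ha hl hΩ (zero_mem_strip hl ξ))
    have hC : ContDiffAt ℝ k (flow a U) (0, ξ) :=
      contDiffAt_flow_of_localFlow hU ha hl hΩ hW hφC hφ0 (fun x hx t ht => (hφ x hx t ht).2)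
        h00 h00 (by simpa using hε) hxW (by
          simp only [flow_zero hU ha hl hΩ]
          exact contDiffAt_const.prodMk contDiffAt_id)
    exact ⟨hC, fderiv_flow_zero_injective hU ha hl hΩ ha_in (hC.differentiableAt hk')⟩
  suffices h : Ioi (-l) ⊆ {s | -l < s ∧ G s} from (h (mem_strip.1 hp)).2
  refine isPreconnected_Ioi.subset_of_closure_inter_subset ?_ ⟨0, h00, h00, hG0⟩ ?_
  · rw [isOpen_iff_mem_nhds]
    rintro t ⟨ht, hGt⟩
    filter_upwards [eventually_gt_nhds ht, (hstep t ht).self_of_nhds] with r hr hr'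
    exact ⟨hr, hr' hGt⟩
  · rintro t ⟨htc, ht⟩
    obtain ⟨s, hs, hs'⟩ := mem_closure_iff_nhds.1 htc _ (hstep t ht)
    exact ⟨ht, hs.self_of_nhds hs'.2⟩

theorem flowImage_subset : flowImage a U l ⊆ U := by
  rintro _ ⟨p, hp, rfl⟩
  exact flow_mem hU ha hl hΩ hp

theorem isDiffeoOn_flow {k : ℕ} (hk : k ≠ 0) (hak : ContDiffOn ℝ k a U)
    (ha_in : ∀ ξ : Transverse d, 0 < (a (0, ξ)).1) :
    IsDiffeoOn k (flow a U) (strip d l) (flowImage a U l) :=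
  isDiffeoOn_image hk (isOpen_strip d l)
    (fun _ hp => (contDiffAt_flow_and_injective hU ha hl hΩ hk hak ha_in hp).1.contDiffWithinAt)
    (injOn_flow hU ha hl hΩ ha_in)
    fun _ hp => (contDiffAt_flow_and_injective hU ha hl hΩ hk hak ha_in hp).2

end Flow

/-! ### Test functions -/

/-- `φ` is a compactly supported function of class `C¹` with support in `V`. -/
structure IsTestFunction {X : Type*} [NormedAddCommGroup X] [NormedSpace ℝ X] (V : Set X)
    (φ : X → ℝ) : Prop where
  contDiff : ContDiff ℝ 1 φ
  hasCompactSupport : HasCompactSupport φ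
  tsupport_subset : tsupport φ ⊆ V

theorem continuous_mul_of_tsupport_subset {X : Type*} [TopologicalSpace X] {V : Set X}
    (hV : IsOpen V) {φ f : X → ℝ} (hφ : Continuous φ) (hsupp : tsupport φ ⊆ V)
    (hf : ContinuousOn f V) : Continuous fun x => f x * φ x := by
  refine continuous_of_tsupport fun x hx => ?_
  have hxV : x ∈ V := hsupp (tsupport_mul_subset_right hx)
  exact (hf.continuousAt (hV.mem_nhds hxV)).mul hφ.continuousAt

section TestFunction

variable {X : Type*} [NormedAddCommGroup X] [NormedSpace ℝ X] {V : Set X} {φ : X → ℝ}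

theorem IsTestFunction.eq_zero (hφ : IsTestFunction V φ) {x : X} (hx : x ∉ V) : φ x = 0 :=
  image_eq_zero_of_notMem_tsupport fun h => hx (hφ.tsupport_subset h)

theorem IsTestFunction.fderiv_eq_zero (hφ : IsTestFunction V φ) {x : X} (hx : x ∉ V) :
    fderiv ℝ φ x = 0 :=
  image_eq_zero_of_notMem_tsupport fun h => hx (hφ.tsupport_subset (tsupport_fderiv_subset ℝ h))

theorem IsTestFunction.differentiableAt (hφ : IsTestFunction V φ) (x : X) :
    DifferentiableAt ℝ φ x :=
  hφ.contDiff.differentiable (by norm_num) x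

theorem IsTestFunction.integrable_mul [MeasurableSpace X] [BorelSpace X]
    {μ : Measure X} [IsFiniteMeasureOnCompacts μ] (hφ : IsTestFunction V φ) (hV : IsOpen V)
    {f : X → ℝ} (hf : ContinuousOn f V) : Integrable (fun x => f x * φ x) μ :=
  (continuous_mul_of_tsupport_subset hV hφ.contDiff.continuous hφ.tsupport_subset
    hf).integrable_of_hasCompactSupport hφ.hasCompactSupport.mul_left

theorem IsTestFunction.integrable_mul_fderiv [MeasurableSpace X] [BorelSpace X]
    {μ : Measure X} [IsFiniteMeasureOnCompacts μ] (hφ : IsTestFunction V φ) (hV : IsOpen V)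
    {f : X → ℝ} (hf : ContinuousOn f V) {b : X → X} (hb : ContinuousOn b V) :
    Integrable (fun x => f x * fderiv ℝ φ x (b x)) μ := by
  have hsupp : ∀ x, x ∉ tsupport φ → f x * fderiv ℝ φ x (b x) = 0 := fun x hx => by
    rw [image_eq_zero_of_notMem_tsupport fun h => hx (tsupport_fderiv_subset ℝ h)]
    simp
  refine Continuous.integrable_of_hasCompactSupport ?_
    (HasCompactSupport.intro hφ.hasCompactSupport hsupp)
  refine continuous_of_tsupport fun x hx => ?_
  have hxV : x ∈ V := by
    refine hφ.tsupport_subset (closure_minimal ?_ (isClosed_tsupport φ) hx)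
    exact fun y hy => by_contra fun h => hy (hsupp y h)
  exact (hf.continuousAt (hV.mem_nhds hxV)).mul
    ((hφ.contDiff.continuous_fderiv (by norm_num)).continuousAt.clm_apply
      (hb.continuousAt (hV.mem_nhds hxV)))

/-- A test function carried over by a diffeomorphism and extended by zero is a test function. -/
theorem IsTestFunction.indicator_comp {Y : Type*} [NormedAddCommGroup Y] [NormedSpace ℝ Y]
    {W : Set Y} (hφ : IsTestFunction V φ) {f : X → Y} {f' : Y → X} (hW : IsOpen W)
    (hf : ContinuousOn f V) (hmaps : MapsTo f V W)
    (hinv : InvOn f' f V W) (hf' : ContDiffOn ℝ 1 f' W) :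
    IsTestFunction W (W.indicator (φ ∘ f')) := by
  set K := f '' tsupport φ with hK
  have hKc : IsCompact K := hφ.hasCompactSupport.isCompact.image_of_continuousOn
    (hf.mono hφ.tsupport_subset)
  have hKW : K ⊆ W := by
    rintro _ ⟨x, hx, rfl⟩
    exact hmaps (hφ.tsupport_subset hx)
  have hzero : ∀ y, y ∉ K → W.indicator (φ ∘ f') y = 0 := fun y hy => by
    by_cases hyW : y ∈ W
    · rw [indicator_of_mem hyW]
      exact image_eq_zero_of_notMem_tsupport (f := φ) fun h => hy ⟨f' y, h, hinv.2 hyW⟩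
    · exact indicator_of_notMem hyW _
  have hsub : tsupport (W.indicator (φ ∘ f')) ⊆ K :=
    closure_minimal (fun y hy => by_contra fun h => hy (hzero y h)) hKc.isClosed
  refine ⟨contDiff_iff_contDiffAt.2 fun y => ?_, HasCompactSupport.intro hKc hzero, hsub.trans hKW⟩
  by_cases hy : y ∈ K
  swap
  · refine contDiffAt_const (c := (0 : ℝ)) |>.congr_of_eventuallyEq ?_
    filter_upwards [hKc.isClosed.isOpen_compl.mem_nhds hy] with z hz using hzero z hz
  have hyW := hW.mem_nhds (hKW hy)
  refine (hφ.contDiff.contDiffAt.comp y (hf'.contDiffAt hyW)).congr_of_eventuallyEq ?_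
  filter_upwards [hyW] with z hz
  exact indicator_of_mem hz _

end TestFunction

/-! ### The weak equation on a strip -/

theorem hasDerivAt_integral_of_continuousOn {B : Type*} [NormedAddCommGroup B] [NormedSpace ℝ B]
    [CompleteSpace B] {l : ℝ} (hl : 0 < l) {f : ℝ → B}
    (hf : ContinuousOn f (Ioi (-l))) {s : ℝ} (hs : -l < s) :
    HasDerivAt (fun s => ∫ r in (0 : ℝ)..s, f r) (f s) s := by
  have hsub : uIcc 0 s ⊆ Ioi (-l) :=
    ordConnected_Ioi.uIcc_subset (by simpa using hl) hs
  exact intervalIntegral.integral_hasDerivAt_right (hf.mono hsub).intervalIntegrable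
    (hf.stronglyMeasurableAtFilter isOpen_Ioi s hs) (hf.continuousAt (Ioi_mem_nhds hs))

/-- **Du Bois-Reymond lemma**: a continuous function whose distributional derivative vanishes is
constant. -/
theorem exists_eq_const_of_integral_mul_deriv_eq_zero {l : ℝ} (hl : 0 < l) {w : ℝ → ℝ}
    (hw : ContinuousOn w (Ioi (-l)))
    (h : ∀ α : ℝ → ℝ, IsTestFunction (Ioi (-l)) α → ∫ s, w s * deriv α s = 0) :
    ∃ C, ∀ s, -l < s → w s = C := by
  let b : ContDiffBump (0 : ℝ) := ⟨l / 4, l / 2, by linarith, by linarith⟩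
  set ρ : ℝ → ℝ := b.normed volume with hρ
  have hρC : Continuous ρ := b.continuous_normed
  have hρK : HasCompactSupport ρ := b.hasCompactSupport_normed
  have hρS : tsupport ρ ⊆ Ioi (-l) := by
    rw [hρ, b.tsupport_normed_eq, Real.closedBall_eq_Icc]
    intro x hx
    have := hx.1
    simp only [b, mem_Ioi] at this ⊢
    linarith
  have hintegrable : ∀ {g : ℝ → ℝ}, Continuous g → HasCompactSupport g → tsupport g ⊆ Ioi (-l) →
      Integrable (fun s => w s * g s) := fun hg hgK hgS =>
    (continuous_mul_of_tsupport_subset isOpen_Ioi hg hgS hw).integrable_of_hasCompactSupport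
      hgK.mul_left
  refine ⟨∫ s, w s * ρ s, ?_⟩
  set C := ∫ s, w s * ρ s with hC
  have hae : ∀ᵐ s, s ∈ Ioi (-l) → w s - C = 0 := by
    refine isOpen_Ioi.ae_eq_zero_of_integral_contDiff_smul_eq_zero
      ((hw.sub continuousOn_const).locallyIntegrableOn measurableSet_Ioi) ?_
    intro g hg hgK hgS
    -- `g - (∫ g) ρ` has integral zero, hence a compactly supported primitive
    set G := ∫ s, g s with hG
    set β : ℝ → ℝ := fun s => g s - G * ρ s with hβ
    have hβC : Continuous β := hg.continuous.sub (continuous_const.mul hρC)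
    have hgI : Integrable g := hg.continuous.integrable_of_hasCompactSupport hgK
    have hρI : Integrable ρ := hρC.integrable_of_hasCompactSupport hρK
    have hβI : Integrable β := hgI.sub (hρI.const_mul G)
    have hβ0 : ∫ s, β s = 0 := by
      rw [hβ, integral_sub hgI (hρI.const_mul G), integral_const_mul, hρ, b.integral_normed]
      simp [hG]
    have hKc : IsCompact (tsupport g ∪ tsupport ρ) := hgK.isCompact.union hρK.isCompact
    have hKsub : tsupport g ∪ tsupport ρ ⊆ Ioi (-l) := union_subset hgS hρS
    have h0K : (tsupport g ∪ tsupport ρ).Nonempty := by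
      refine ⟨0, Or.inr (subset_tsupport _ ?_)⟩
      rw [hρ, b.support_normed_eq]
      simpa using b.rOut_pos
    obtain ⟨A, hAK, hA⟩ := hKc.exists_isLeast h0K
    obtain ⟨B, hBK, hB⟩ := hKc.exists_isGreatest h0K
    have hβz : ∀ s, s ∉ Icc A B → β s = 0 := fun s hs => by
      have hs' : s ∉ tsupport g ∪ tsupport ρ := fun h => hs ⟨hA h, hB h⟩
      simp only [mem_union, not_or] at hs'
      simp [hβ, image_eq_zero_of_notMem_tsupport hs'.1, image_eq_zero_of_notMem_tsupport hs'.2]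
    set α : ℝ → ℝ := fun s => ∫ r in A..s, β r with hα
    have hαd : ∀ s, HasDerivAt α (β s) s := fun s => hβC.integral_hasStrictDerivAt A s |>.hasDerivAt
    have hderiv : deriv α = β := funext fun s => (hαd s).deriv
    have hαz : ∀ s, s ∉ Icc A B → α s = 0 := by
      intro s hs
      rcases lt_or_ge s A with hsA | hsA
      · rw [hα]
        beta_reduce
        rw [intervalIntegral.integral_symm, intervalIntegral.integral_of_le hsA.le,
          integral_Ioc_eq_integral_Ioo, setIntegral_eq_zero_of_forall_eq_zero, neg_zero]
        exact fun r hr => hβz r fun h => (h.1.trans_lt hr.2).false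
      · have hsB : B < s := not_le.1 fun h => hs ⟨hsA, h⟩
        rw [hα]
        beta_reduce
        rw [intervalIntegral.integral_of_le hsA, ← integral_Icc_eq_integral_Ioc,
          setIntegral_eq_integral_of_forall_compl_eq_zero, hβ0]
        exact fun r hr => hβz r fun h => hr ⟨h.1, h.2.trans hsB.le⟩
    have hαtest : IsTestFunction (Ioi (-l)) α := by
      refine ⟨?_, HasCompactSupport.intro isCompact_Icc hαz, ?_⟩
      · rw [contDiff_one_iff_deriv, hderiv]
        exact ⟨fun s => (hαd s).differentiableAt, hβC⟩
      · refine (closure_minimal (fun y hy => by_contra fun h => hy (hαz y h))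
          isClosed_Icc : tsupport α ⊆ Icc A B).trans fun y hy => ?_
        exact (hKsub hAK : -l < A).trans_le hy.1
    have key := h α hαtest
    rw [hderiv] at key
    have e1 : ∀ s, w s * β s = w s * g s - G * (w s * ρ s) := fun s => by simp only [hβ]; ring
    simp only [e1] at key
    rw [integral_sub (hintegrable hg.continuous hgK hgS)
      ((hintegrable hρC hρK hρS).const_mul G), integral_const_mul, ← hC] at key
    have e2 : ∀ s, g s • (w s - C) = w s * g s - C * g s := fun s => by
      simp only [smul_eq_mul]; ring
    simp only [e2]
    rw [integral_sub (hintegrable hg.continuous hgK hgS) (hgI.const_mul C), integral_const_mul,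
      ← hG]
    linarith
  have hEq : EqOn w (fun _ => C) (Ioi (-l)) := by
    refine Measure.eqOn_open_of_ae_eq (μ := volume) ?_ isOpen_Ioi hw continuousOn_const
    rw [EventuallyEq, ae_restrict_iff' measurableSet_Ioi]
    filter_upwards [hae] with s hs hs'
    exact sub_eq_zero.1 (hs hs')
  exact fun s hs => hEq hs

/-- The one-dimensional weak equation `z' = -h` with continuous `z` and `h` holds pointwise: apply
the du Bois-Reymond lemma to `z + ∫ h`. -/
theorem hasDerivAt_of_forall_integral_eq_zero {l : ℝ} (hl : 0 < l) {z h : ℝ → ℝ}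
    (hz : ContinuousOn z (Ioi (-l))) (hh : ContinuousOn h (Ioi (-l)))
    (H : ∀ α : ℝ → ℝ, IsTestFunction (Ioi (-l)) α →
      ∫ s, (-(z s * deriv α s) + h s * α s) = 0) {s : ℝ} (hs : -l < s) :
    HasDerivAt z (-h s) s := by
  set K : ℝ → ℝ := fun s => ∫ r in (0 : ℝ)..s, h r with hK
  have hKd : ∀ s, -l < s → HasDerivAt K (h s) s := fun s hs =>
    hasDerivAt_integral_of_continuousOn hl hh hs
  have hKc : ContinuousOn K (Ioi (-l)) := fun s hs => (hKd s hs).continuousAt.continuousWithinAt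
  obtain ⟨C, hC⟩ := exists_eq_const_of_integral_mul_deriv_eq_zero hl (hz.add hKc) fun α hα => by
    have hαd : ∀ x, HasDerivAt α (deriv α x) x := fun x => (hα.differentiableAt x).hasDerivAt
    have hint : ∀ {f : ℝ → ℝ}, ContinuousOn f (Ioi (-l)) →
        Integrable fun s => f s * deriv α s := fun hf => by
      simpa only [fderiv_eq_smul_deriv, one_smul] using
        hα.integrable_mul_fderiv (μ := volume) isOpen_Ioi hf (b := fun _ => 1) continuousOn_const
    have hparts := integral_mul_deriv_eq_deriv_mul_of_integrable (u := K) (v := α) (u' := h)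
      (v' := deriv α) (fun x hx => hKd x (hα.tsupport_subset hx)) (fun x _ => hαd x)
      (hint hKc) (hα.integrable_mul isOpen_Ioi hh) (hα.integrable_mul isOpen_Ioi hKc)
    have := H α hα
    simp only [neg_add_eq_sub] at this
    rw [integral_sub (hα.integrable_mul isOpen_Ioi hh) (hint hz)] at this
    simp only [Pi.add_apply, add_mul]
    rw [integral_add (hint hz) (hint hKc), hparts]
    linarith
  have hev : z =ᶠ[𝓝 s] fun s => C - K s := by
    filter_upwards [Ioi_mem_nhds hs] with r hr
    have := hC r hr
    simp only [Pi.add_apply] at this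
    linarith
  exact ((hKd s hs).const_sub C).congr_of_eventuallyEq hev

section Strip

variable {d : ℕ} {l : ℝ}

theorem continuousOn_slice {Y : Type*} [TopologicalSpace Y] {Z : ℝ × Transverse d → Y}
    (hZ : ContinuousOn Z (strip d l)) (ξ : Transverse d) :
    ContinuousOn (fun s => Z (s, ξ)) (Ioi (-l)) :=
  hZ.comp (by fun_prop) fun s hs => mem_strip.2 hs

theorem hasDerivAt_slice {ψ : ℝ × Transverse d → ℝ} {p : ℝ × Transverse d}
    (hψ : DifferentiableAt ℝ ψ p) :
    HasDerivAt (fun s => ψ (s, p.2)) (fderiv ℝ ψ p (1, 0)) p.1 :=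
  HasFDerivAt.comp_hasDerivAt p.1 (f := fun s => (s, p.2)) hψ.hasFDerivAt
    ((hasDerivAt_id p.1).prodMk (hasDerivAt_const p.1 p.2))

theorem IsTestFunction.slice {ψ : ℝ × Transverse d → ℝ} (hψ : IsTestFunction (strip d l) ψ)
    (ξ : Transverse d) : IsTestFunction (Ioi (-l)) fun s => ψ (s, ξ) := by
  have hsub : tsupport (fun s => ψ (s, ξ)) ⊆ (fun s => (s, ξ)) ⁻¹' tsupport ψ :=
    tsupport_comp_subset_preimage ψ (f := fun s => (s, ξ)) (by fun_prop)
  refine ⟨hψ.contDiff.comp (by fun_prop), ?_, hsub.trans fun s hs =>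
    mem_strip.1 (hψ.tsupport_subset hs)⟩
  refine HasCompactSupport.intro (hψ.hasCompactSupport.isCompact.image continuous_fst)
    fun s hs => image_eq_zero_of_notMem_tsupport fun h => hs ⟨_, h, rfl⟩

/-- The weak form of `∂_s Z = -H` on a strip, with continuous `Z` and `H`, amounts to the pointwise
equation on each line. -/
theorem forall_integral_eq_zero_iff_hasDerivAt (hl : 0 < l) {Z H : ℝ × Transverse d → ℝ}
    (hZ : ContinuousOn Z (strip d l)) (hH : ContinuousOn H (strip d l)) :
    (∀ ψ : ℝ × Transverse d → ℝ, IsTestFunction (strip d l) ψ →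
      ∫ p, (-(Z p * fderiv ℝ ψ p (1, 0)) + H p * ψ p) = 0) ↔
    ∀ p ∈ strip d l, HasDerivAt (fun s => Z (s, p.2)) (-H p) p.1 := by
  constructor
  · intro h
    rintro ⟨s, ξ⟩ hs
    refine hasDerivAt_of_forall_integral_eq_zero (h := fun s => H (s, ξ)) hl
      (continuousOn_slice hZ ξ) (continuousOn_slice hH ξ) ?_ (mem_strip.1 hs)
    intro α hα
    -- test functions `α(s) β(ξ)`: the integral over the line of `ξ` is continuous in `ξ` and
    -- orthogonal to every `β`
    set q : Transverse d → ℝ := fun ξ =>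
      ∫ s, (-(Z (s, ξ) * deriv α s) + H (s, ξ) * α s) with hq
    suffices hq0 : ∀ ξ, q ξ = 0 from hq0 ξ
    have hα' : Continuous (deriv α) := hα.contDiff.continuous_deriv (by norm_num)
    have hsupp : ∀ {g : ℝ → ℝ}, tsupport g ⊆ tsupport α →
        tsupport (fun p : ℝ × Transverse d => g p.1) ⊆ strip d l := fun {g} hg =>
      (tsupport_comp_subset_preimage g (f := Prod.fst) continuous_fst).trans fun p hp =>
        mem_strip.2 (hα.tsupport_subset (hg hp))
    have hcont : Continuous fun p : ℝ × Transverse d =>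
        -(Z p * deriv α p.1) + H p * α p.1 :=
      (continuous_mul_of_tsupport_subset (isOpen_strip d l) (hα'.comp continuous_fst)
        (hsupp tsupport_deriv_subset) hZ).neg.add
      (continuous_mul_of_tsupport_subset (isOpen_strip d l)
        (hα.contDiff.continuous.comp continuous_fst) (hsupp le_rfl) hH)
    have hqc : Continuous q := by
      have h1 := continuous_parametric_integral_of_continuous (μ := volume)
        (f := fun (ξ : Transverse d) (s : ℝ) => -(Z (s, ξ) * deriv α s) + H (s, ξ) * α s)
        (hcont.comp continuous_swap) hα.hasCompactSupport.isCompact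
      refine h1.congr fun ξ => setIntegral_eq_integral_of_forall_compl_eq_zero fun s hs => ?_
      rw [image_eq_zero_of_notMem_tsupport hs,
        image_eq_zero_of_notMem_tsupport fun h => hs (tsupport_deriv_subset h)]
      simp
    have hae : ∀ᵐ ξ, q ξ = 0 := by
      refine ae_eq_zero_of_integral_contDiff_smul_eq_zero hqc.locallyIntegrable ?_
      intro β hβ hβK
      have hβ1 : ContDiff ℝ 1 β := hβ.of_le (by exact_mod_cast le_top)
      have hψ : IsTestFunction (strip d l) fun p => α p.1 * β p.2 := by
        refine ⟨(hα.contDiff.comp contDiff_fst).mul (hβ1.comp contDiff_snd), ?_, ?_⟩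
        · refine HasCompactSupport.intro (hα.hasCompactSupport.isCompact.prod hβK.isCompact)
            fun p hp => ?_
          by_cases h1 : p.1 ∈ tsupport α
          · rw [image_eq_zero_of_notMem_tsupport fun h2 => hp ⟨h1, h2⟩, mul_zero]
          · rw [image_eq_zero_of_notMem_tsupport h1, zero_mul]
        · exact tsupport_mul_subset_left.trans (hsupp (g := α) le_rfl)
      have hψd : ∀ p : ℝ × Transverse d,
          fderiv ℝ (fun p : ℝ × Transverse d => α p.1 * β p.2) p (1, 0) =
            deriv α p.1 * β p.2 := fun p =>
        (hasDerivAt_slice (hψ.differentiableAt p)).unique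
          ((hα.differentiableAt p.1).hasDerivAt.mul_const (β p.2))
      have key := h _ hψ
      have hint : Integrable fun p : ℝ × Transverse d =>
          (-(Z p * deriv α p.1) + H p * α p.1) * β p.2 := by
        refine Continuous.integrable_of_hasCompactSupport
          (hcont.mul (hβ.continuous.comp continuous_snd)) ?_
        refine HasCompactSupport.intro (hα.hasCompactSupport.isCompact.prod hβK.isCompact)
          fun p hp => ?_
        by_cases h1 : p.1 ∈ tsupport α
        · rw [image_eq_zero_of_notMem_tsupport fun h2 => hp ⟨h1, h2⟩, mul_zero]
        · rw [image_eq_zero_of_notMem_tsupport h1,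
            image_eq_zero_of_notMem_tsupport fun h => h1 (tsupport_deriv_subset h)]
          simp
      have e1 : ∀ p : ℝ × Transverse d, -(Z p * fderiv ℝ (fun p : ℝ × Transverse d =>
          α p.1 * β p.2) p (1, 0)) + H p * (α p.1 * β p.2) =
          (-(Z p * deriv α p.1) + H p * α p.1) * β p.2 := fun p => by rw [hψd]; ring
      simp only [e1] at key
      rw [Measure.volume_eq_prod] at key hint
      rw [integral_prod_symm _ hint] at key
      simp only [integral_mul_const] at key
      simpa only [hq, smul_eq_mul, mul_comm] using key
    exact fun ξ => congrFun ((hqc.ae_eq_iff_eq volume continuous_zero).1 hae) ξ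
  · intro h ψ hψ
    have hint : Integrable fun p => -(Z p * fderiv ℝ ψ p (1, 0)) + H p * ψ p :=
      (hψ.integrable_mul_fderiv (isOpen_strip d l) hZ (b := fun _ => (1, 0))
        continuousOn_const).neg.add (hψ.integrable_mul (isOpen_strip d l) hH)
    rw [Measure.volume_eq_prod] at hint ⊢
    rw [integral_prod_symm _ hint]
    refine integral_eq_zero_of_ae (Eventually.of_forall fun ξ => ?_)
    have hξ := hψ.slice ξ
    have hderiv : ∀ s, HasDerivAt (fun s => ψ (s, ξ)) (fderiv ℝ ψ (s, ξ) (1, 0)) s := fun s =>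
      hasDerivAt_slice (p := (s, ξ)) (hψ.differentiableAt _)
    have hi1 : Integrable fun s => Z (s, ξ) * fderiv ℝ ψ (s, ξ) (1, 0) := by
      have := hξ.integrable_mul_fderiv (μ := volume) isOpen_Ioi (continuousOn_slice hZ ξ)
        (b := fun _ => 1) continuousOn_const
      simpa only [fderiv_eq_smul_deriv, one_smul, (hderiv _).deriv] using this
    have hi2 := hξ.integrable_mul (μ := volume) isOpen_Ioi (continuousOn_slice hH ξ)
    have hparts := integral_mul_deriv_eq_deriv_mul_of_integrable (u := fun s => Z (s, ξ))
      (v := fun s => ψ (s, ξ)) (u' := fun s => -H (s, ξ))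
      (v' := fun s => fderiv ℝ ψ (s, ξ) (1, 0))
      (fun s hs => h (s, ξ) (mem_strip.2 (hξ.tsupport_subset hs))) (fun s _ => hderiv s) hi1
      (hi2.neg.congr (Eventually.of_forall fun s => by simp))
      (hξ.integrable_mul isOpen_Ioi (continuousOn_slice hZ ξ))
    simp only [neg_add_eq_sub]
    rw [integral_sub hi2 hi1, hparts]
    simp [integral_neg]

end Strip

/-! ### The divergence -/

section Divergence

variable {d : ℕ}

theorem divergence_smul {u : Space d → ℝ} {a : Space d → Space d} {x : Space d}
    (hu : DifferentiableAt ℝ u x) (ha : DifferentiableAt ℝ a x) :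
    divergence (fun y => u y • a y) x = fderiv ℝ u x (a x) + u x * divergence a x := by
  have h1 : fderiv ℝ (fun y => u y • a y) x = u x • fderiv ℝ a x + (fderiv ℝ u x).smulRight (a x) :=
    (hu.hasFDerivAt.smul ha.hasFDerivAt).fderiv
  have h2 : a x = (a x).1 • ((1, 0) : Space d) +
      ∑ j, (a x).2 j • ((0, EuclideanSpace.single j 1) : Space d) := by
    refine Prod.ext ?_ ?_
    · simp [Prod.fst_sum]
    · ext i
      simp [Prod.snd_sum, Pi.single_apply]
  have h3 : fderiv ℝ u x (a x) = (a x).1 * fderiv ℝ u x (1, 0) +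
      ∑ j, (a x).2 j * fderiv ℝ u x (0, EuclideanSpace.single j 1) := by
    conv_lhs => rw [h2]
    simp only [map_add, map_sum, map_smul, smul_eq_mul]
  rw [h3]
  simp only [divergence, h1, add_apply, smul_apply,
    ContinuousLinearMap.smulRight_apply, Prod.fst_add, Prod.smul_fst, Prod.snd_add, Prod.smul_snd,
    PiLp.add_apply, PiLp.smul_apply, smul_eq_mul, Finset.sum_add_distrib, mul_add, Finset.mul_sum]
  simp only [mul_comm]
  ring

theorem contDiffOn_divergence {a : Space d → Space d} {U : Set (Space d)} (hU : IsOpen U) {m : ℕ}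
    (ha : ContDiffOn ℝ (m + 1 : ℕ) a U) : ContDiffOn ℝ m (divergence a) U := by
  have h1 : ContDiffOn ℝ m (fderiv ℝ a) U := ha.fderiv_of_isOpen hU (by norm_cast)
  have h2 : ∀ v, ContDiffOn ℝ m (fun x => fderiv ℝ a x v) U := fun v =>
    h1.clm_apply contDiffOn_const
  refine ContDiffOn.add (contDiff_fst.comp_contDiffOn (h2 _)) (ContDiffOn.sum fun j _ => ?_)
  exact (EuclideanSpace.proj (𝕜 := ℝ) j).contDiff.comp_contDiffOn
    (contDiff_snd.comp_contDiffOn (h2 _))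

instance isAddHaarMeasure_volume_space : (volume : Measure (Space d)).IsAddHaarMeasure := by
  rw [Measure.volume_eq_prod]
  infer_instance

theorem integral_fderiv_eq_zero {f : Space d → ℝ} (hf : ContDiff ℝ 1 f) (hfK : HasCompactSupport f)
    (v : Space d) : ∫ x, fderiv ℝ f x v = 0 := by
  have hi : Integrable fun x => fderiv ℝ f x v :=
    ((hf.continuous_fderiv (by norm_num)).clm_apply
      continuous_const).integrable_of_hasCompactSupport (hfK.fderiv_apply ℝ v)
  have := integral_mul_fderiv_eq_neg_fderiv_mul_of_integrable (μ := volume) (𝕜 := ℝ)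
    (f := fun _ : Space d => (1 : ℝ)) (g := f) (v := v) (by simp) (by simpa using hi)
    (by simpa using hf.continuous.integrable_of_hasCompactSupport hfK) (fun x _ => by fun_prop)
    (fun x _ => hf.differentiable (by norm_num) x)
  simpa using this

/-- The divergence theorem for compactly supported vector fields. -/
theorem integral_divergence_eq_zero {F : Space d → Space d} (hF : ContDiff ℝ 1 F)
    (hFK : HasCompactSupport F) : ∫ x, divergence F x = 0 := by
  have hd : ∀ x, HasFDerivAt F (fderiv ℝ F x) x := fun x =>
    (hF.differentiable (by norm_num) x).hasFDerivAt
  have key : ∀ (L : Space d →L[ℝ] ℝ) (v : Space d), Integrable (fun x => L (fderiv ℝ F x v)) ∧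
      ∫ x, L (fderiv ℝ F x v) = 0 := by
    intro L v
    have h1 : ContDiff ℝ 1 fun x => L (F x) := L.contDiff.comp hF
    have h2 : HasCompactSupport fun x => L (F x) := hFK.comp_left (map_zero L)
    have h3 : ∀ x, fderiv ℝ (fun x => L (F x)) x v = L (fderiv ℝ F x v) := fun x => by
      have : HasFDerivAt (fun x => L (F x)) (L.comp (fderiv ℝ F x)) x :=
        L.hasFDerivAt.comp x (hd x)
      rw [this.fderiv]; rfl
    refine ⟨?_, by simpa only [h3] using integral_fderiv_eq_zero h1 h2 v⟩
    have : Integrable fun x => fderiv ℝ (fun x => L (F x)) x v :=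
      ((h1.continuous_fderiv (by norm_num)).clm_apply
        continuous_const).integrable_of_hasCompactSupport (h2.fderiv_apply ℝ v)
    simpa only [h3] using this
  have k1 := key (ContinuousLinearMap.fst ℝ ℝ (Transverse d)) (1, 0)
  have k2 : ∀ j : Fin (d - 1), _ := fun j => key
    ((EuclideanSpace.proj (𝕜 := ℝ) j).comp (ContinuousLinearMap.snd ℝ ℝ (Transverse d)))
    (0, EuclideanSpace.single j 1)
  have hdef : ∀ x, divergence F x = ContinuousLinearMap.fst ℝ ℝ (Transverse d)
      (fderiv ℝ F x (1, 0)) + ∑ j, ((EuclideanSpace.proj (𝕜 := ℝ) j).comp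
        (ContinuousLinearMap.snd ℝ ℝ (Transverse d)))
        (fderiv ℝ F x (0, EuclideanSpace.single j 1)) := fun x => rfl
  simp only [hdef]
  rw [integral_add k1.1 (integrable_finsetSum _ fun j _ => (k2 j).1), k1.2,
    integral_finsetSum _ fun j _ => (k2 j).1]
  simp only [(k2 _).2, Finset.sum_const_zero, add_zero]

/-- The weak form of `div (1 · a) - div a = 0`. -/
theorem integral_neg_fderiv_sub_divergence_mul {a : Space d → Space d} {U V : Set (Space d)}
    (hU : IsOpen U) (ha : ContDiffOn ℝ 1 a U) (hVU : V ⊆ U) {φ : Space d → ℝ}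
    (hφ : IsTestFunction V φ) :
    ∫ x, (-(1 * fderiv ℝ φ x (a x)) + -divergence a x * φ x) = 0 := by
  have hzero : ∀ x, x ∉ tsupport φ → φ x • a x = 0 := fun x hx => by
    rw [image_eq_zero_of_notMem_tsupport hx, zero_smul]
  have haU : ∀ x ∈ U, ContDiffAt ℝ 1 a x := fun x hx => ha.contDiffAt (hU.mem_nhds hx)
  have hC : ContDiff ℝ 1 fun x => φ x • a x := by
    refine contDiff_iff_contDiffAt.2 fun x => ?_
    by_cases hx : x ∈ tsupport φ
    · exact hφ.contDiff.contDiffAt.smul (haU x (hVU (hφ.tsupport_subset hx)))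
    · refine contDiffAt_const (c := (0 : Space d)) |>.congr_of_eventuallyEq ?_
      filter_upwards [(isClosed_tsupport φ).isOpen_compl.mem_nhds hx] with z hz using hzero z hz
  have h0 := integral_divergence_eq_zero hC (HasCompactSupport.intro hφ.hasCompactSupport hzero)
  have heq : ∀ x, -(1 * fderiv ℝ φ x (a x)) + -divergence a x * φ x =
      -divergence (fun x => φ x • a x) x := by
    intro x
    by_cases hx : x ∈ tsupport φ
    · rw [divergence_smul (hφ.differentiableAt x)
        ((haU x (hVU (hφ.tsupport_subset hx))).differentiableAt (by norm_num))]
      ring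
    · have h1 : (fun x => φ x • a x) =ᶠ[𝓝 x] fun _ => 0 := by
        filter_upwards [(isClosed_tsupport φ).isOpen_compl.mem_nhds hx] with z hz using hzero z hz
      have h2 : fderiv ℝ (fun x => φ x • a x) x = 0 := by
        rw [h1.fderiv_eq]; simp
      rw [image_eq_zero_of_notMem_tsupport hx,
        image_eq_zero_of_notMem_tsupport fun h => hx (tsupport_fderiv_subset ℝ h)]
      simp [divergence, h2]
  simp only [heq, integral_neg, h0, neg_zero]

end Divergence

/-! ### The weak equation along the characteristics -/

section Characteristics

variable {d : ℕ} {a : Space d → Space d} {U : Set (Space d)} {l : ℝ}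

/-- The Jacobian `|det DΦ|` of the flow. -/
def flowJacobian (a : Space d → Space d) (U : Set (Space d)) (p : ℝ × Transverse d) : ℝ :=
  |(fderiv ℝ (flow a U) p).det|

variable (hU : IsOpen U) (ha : ContDiffOn ℝ 1 a U) (hl : 0 < l)
  (hΩ : strip d l ⊆ flowDomain a U) (ha_in : ∀ ξ : Transverse d, 0 < (a (0, ξ)).1)

include hU ha hl hΩ ha_in

theorem isDiffeoOn_one_flow : IsDiffeoOn 1 (flow a U) (strip d l) (flowImage a U l) :=
  isDiffeoOn_flow hU ha hl hΩ one_ne_zero (by exact_mod_cast ha) ha_in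

theorem contDiffOn_one_flow : ContDiffOn ℝ 1 (flow a U) (strip d l) := by
  have := (isDiffeoOn_one_flow hU ha hl hΩ ha_in).2.2.2.1
  exact_mod_cast this

theorem isOpen_flowImage : IsOpen (flowImage a U l) :=
  (isDiffeoOn_one_flow hU ha hl hΩ ha_in).2.1

theorem hasFDerivAt_flow {p : ℝ × Transverse d} (hp : p ∈ strip d l) :
    HasFDerivAt (flow a U) (fderiv ℝ (flow a U) p) p :=
  (((contDiffOn_one_flow hU ha hl hΩ ha_in).contDiffAt
    ((isOpen_strip d l).mem_nhds hp)).differentiableAt (by norm_num)).hasFDerivAt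

theorem fderiv_flow_one_zero {p : ℝ × Transverse d} (hp : p ∈ strip d l) :
    fderiv ℝ (flow a U) p (1, 0) = a (flow a U p) := by
  have h1 : HasDerivAt (fun s => flow a U (s, p.2)) (fderiv ℝ (flow a U) p (1, 0)) p.1 :=
    HasFDerivAt.comp_hasDerivAt p.1 (f := fun s => (s, p.2))
      (hasFDerivAt_flow hU ha hl hΩ ha_in hp)
      ((hasDerivAt_id p.1).prodMk (hasDerivAt_const p.1 p.2))
  exact h1.unique (hasDerivAt_flow hU ha hl hΩ (mem_strip.1 hp))

theorem continuousOn_flowJacobian : ContinuousOn (flowJacobian a U) (strip d l) :=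
  (ContinuousLinearMap.continuous_det.comp_continuousOn
    ((contDiffOn_one_flow hU ha hl hΩ ha_in).continuousOn_fderiv_of_isOpen (isOpen_strip d l)
      le_rfl)).abs

theorem flowJacobian_pos {p : ℝ × Transverse d} (hp : p ∈ strip d l) : 0 < flowJacobian a U p := by
  refine abs_pos.2 ?_
  have hinj := (contDiffAt_flow_and_injective hU ha hl hΩ one_ne_zero (by exact_mod_cast ha)
    ha_in hp).2
  have := (LinearEquiv.ofInjectiveEndo (fderiv ℝ (flow a U) p : Space d →ₗ[ℝ] Space d)
    hinj).isUnit_det'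
  exact this.ne_zero

/-- Change of variables `x = Φ(s, ξ)` in the weak equation. -/
theorem integral_weak_eq_integral_strip {u h φ : Space d → ℝ} {ψ : ℝ × Transverse d → ℝ}
    (hφ : IsTestFunction (flowImage a U l) φ) (hψ : IsTestFunction (strip d l) ψ)
    (hφψ : ∀ p ∈ strip d l, φ (flow a U p) = ψ p) :
    ∫ x, (-(u x * fderiv ℝ φ x (a x)) + h x * φ x) =
      ∫ p, (-(flowJacobian a U p * u (flow a U p) * fderiv ℝ ψ p (1, 0)) +
        flowJacobian a U p * h (flow a U p) * ψ p) := by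
  have e1 : ∀ x, x ∉ flowImage a U l → -(u x * fderiv ℝ φ x (a x)) + h x * φ x = 0 :=
    fun x hx => by rw [hφ.eq_zero hx, hφ.fderiv_eq_zero hx]; simp
  have e2 : ∀ p, p ∉ strip d l →
      -(flowJacobian a U p * u (flow a U p) * fderiv ℝ ψ p (1, 0)) +
        flowJacobian a U p * h (flow a U p) * ψ p = 0 :=
    fun p hp => by rw [hψ.eq_zero hp, hψ.fderiv_eq_zero hp]; simp
  rw [← setIntegral_eq_integral_of_forall_compl_eq_zero e1,
    ← setIntegral_eq_integral_of_forall_compl_eq_zero e2, flowImage,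
    integral_image_eq_integral_abs_det_fderiv_smul volume
      (isOpen_strip d l).measurableSet
      (fun p hp => (hasFDerivAt_flow hU ha hl hΩ ha_in hp).hasFDerivWithinAt)
      (injOn_flow hU ha hl hΩ ha_in)]
  refine setIntegral_congr_fun (isOpen_strip d l).measurableSet fun p hp => ?_
  have h1 : fderiv ℝ ψ p = (fderiv ℝ φ (flow a U p)).comp (fderiv ℝ (flow a U) p) := by
    have hev : ψ =ᶠ[𝓝 p] φ ∘ flow a U := by
      filter_upwards [(isOpen_strip d l).mem_nhds hp] with q hq using (hφψ q hq).symm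
    exact (((hφ.differentiableAt _).hasFDerivAt.comp p
      (hasFDerivAt_flow hU ha hl hΩ ha_in hp)).congr_of_eventuallyEq hev).fderiv
  have h2 : fderiv ℝ ψ p (1, 0) = fderiv ℝ φ (flow a U p) (a (flow a U p)) := by
    rw [h1, ContinuousLinearMap.comp_apply, fderiv_flow_one_zero hU ha hl hΩ ha_in hp]
  simp only [h2, hφψ p hp, flowJacobian, smul_eq_mul]
  ring

/-- The weak form of `div(a u) + h = 0` on `Ũ_ℓ` amounts to an ordinary differential equation for
`|det DΦ| (u ∘ Φ)` along each characteristic. -/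
theorem forall_integral_eq_zero_iff_hasDerivAt_flow {u h : Space d → ℝ}
    (hu : ContinuousOn u (flowImage a U l)) (hh : ContinuousOn h (flowImage a U l)) :
    (∀ φ : Space d → ℝ, IsTestFunction (flowImage a U l) φ →
      ∫ x, (-(u x * fderiv ℝ φ x (a x)) + h x * φ x) = 0) ↔
    ∀ p ∈ strip d l,
      HasDerivAt (fun s => flowJacobian a U (s, p.2) * u (flow a U (s, p.2)))
        (-(flowJacobian a U p * h (flow a U p))) p.1 := by
  have hΦ := contDiffOn_one_flow hU ha hl hΩ ha_in
  have hmaps : MapsTo (flow a U) (strip d l) (flowImage a U l) := mapsTo_image _ _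
  have hJ := continuousOn_flowJacobian hU ha hl hΩ ha_in
  rw [← forall_integral_eq_zero_iff_hasDerivAt
    (Z := fun p => flowJacobian a U p * u (flow a U p))
    (H := fun p => flowJacobian a U p * h (flow a U p)) hl
    (hJ.mul (hu.comp hΦ.continuousOn hmaps)) (hJ.mul (hh.comp hΦ.continuousOn hmaps))]
  obtain ⟨-, hV, hbij, -, Ψ, hinv, hΨ⟩ := isDiffeoOn_one_flow hU ha hl hΩ ha_in
  have hmaps' : MapsTo Ψ (flowImage a U l) (strip d l) := by
    rintro _ ⟨p, hp, rfl⟩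
    rwa [hinv.1 hp]
  have hΨ1 : ContDiffOn ℝ 1 Ψ (flowImage a U l) := by exact_mod_cast hΨ
  constructor
  · intro H ψ hψ
    have hφ := hψ.indicator_comp hV hΦ.continuousOn hmaps hinv hΨ1
    rw [← H _ hφ, integral_weak_eq_integral_strip hU ha hl hΩ ha_in hφ hψ]
    intro p hp
    rw [indicator_of_mem (hmaps hp), Function.comp_apply, hinv.1 hp]
  · intro H φ hφ
    have hψ := hφ.indicator_comp (isOpen_strip d l) hΨ1.continuousOn hmaps' hinv.symm hΦ
    rw [integral_weak_eq_integral_strip hU ha hl hΩ ha_in hφ hψ]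
    · exact H _ hψ
    · intro p hp
      rw [indicator_of_mem hp, Function.comp_apply]

/-- **Liouville's formula** `∂_s |det DΦ| = |det DΦ| (div a) ∘ Φ`: it expresses, in the variables
`(s, ξ)`, that `div a` is the weak divergence of `a`. -/
theorem hasDerivAt_flowJacobian {p : ℝ × Transverse d} (hp : p ∈ strip d l) :
    HasDerivAt (fun s => flowJacobian a U (s, p.2))
      (flowJacobian a U p * divergence a (flow a U p)) p.1 := by
  have hVU := flowImage_subset hU ha hl hΩ
  have hdiv : ContinuousOn (divergence a) U :=
    (contDiffOn_divergence hU (m := 0) (by exact_mod_cast ha)).continuousOn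
  have := (forall_integral_eq_zero_iff_hasDerivAt_flow hU ha hl hΩ ha_in (u := fun _ => 1)
    (h := fun x => -divergence a x) continuousOn_const (hdiv.mono hVU).neg).1
    (fun φ hφ => integral_neg_fderiv_sub_divergence_mul hU ha hVU hφ) p hp
  simpa using this

/-- A continuous function satisfies `div(a u) + a₀ u = S` weakly if and only if it satisfies
`d/ds u(Φ) = (S - (div a + a₀) u)(Φ)` along each characteristic. -/
theorem weak_equation_iff {a₀ S u : Space d → ℝ} (hu : ContinuousOn u (flowImage a U l))
    (ha₀ : ContinuousOn a₀ (flowImage a U l)) (hS : ContinuousOn S (flowImage a U l)) :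
    (∀ φ : Space d → ℝ, ContDiff ℝ 1 φ → HasCompactSupport φ → tsupport φ ⊆ flowImage a U l →
      ∫ x, (-(u x * fderiv ℝ φ x (a x)) + a₀ x * u x * φ x) = ∫ x, S x * φ x) ↔
    ∀ p ∈ strip d l, HasDerivAt (fun s => u (flow a U (s, p.2)))
      (S (flow a U p) - (divergence a (flow a U p) + a₀ (flow a U p)) * u (flow a U p)) p.1 := by
  have hV := isOpen_flowImage hU ha hl hΩ ha_in
  have hVU := flowImage_subset hU ha hl hΩ
  have hweak : (∀ φ : Space d → ℝ, ContDiff ℝ 1 φ → HasCompactSupport φ →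
      tsupport φ ⊆ flowImage a U l →
      ∫ x, (-(u x * fderiv ℝ φ x (a x)) + a₀ x * u x * φ x) = ∫ x, S x * φ x) ↔
      ∀ φ : Space d → ℝ, IsTestFunction (flowImage a U l) φ →
      ∫ x, (-(u x * fderiv ℝ φ x (a x)) + (a₀ x * u x - S x) * φ x) = 0 := by
    have hsub : ∀ φ, IsTestFunction (flowImage a U l) φ →
        ∫ x, (-(u x * fderiv ℝ φ x (a x)) + (a₀ x * u x - S x) * φ x) =
          (∫ x, (-(u x * fderiv ℝ φ x (a x)) + a₀ x * u x * φ x)) - ∫ x, S x * φ x := by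
      intro φ hφ
      rw [← integral_sub _ (hφ.integrable_mul hV hS)]
      · congr 1
        ext x
        ring
      · exact (hφ.integrable_mul_fderiv hV hu (ha.continuousOn.mono hVU)).neg.add
          (hφ.integrable_mul hV (ha₀.mul hu))
    constructor
    · intro H φ hφ
      rw [hsub φ hφ, H φ hφ.1 hφ.2 hφ.3, sub_self]
    · intro H φ h1 h2 h3
      exact sub_eq_zero.1 ((hsub φ ⟨h1, h2, h3⟩).symm.trans (H φ ⟨h1, h2, h3⟩))
  rw [hweak, forall_integral_eq_zero_iff_hasDerivAt_flow (h := fun x => a₀ x * u x - S x)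
    hU ha hl hΩ ha_in hu ((ha₀.mul hu).sub hS)]
  refine forall₂_congr fun p hp => ?_
  have hJ := hasDerivAt_flowJacobian hU ha hl hΩ ha_in hp
  have hJ0 := (flowJacobian_pos hU ha hl hΩ ha_in hp).ne'
  constructor
  · intro H
    have h1 := H.div hJ hJ0
    have hev : (fun s => u (flow a U (s, p.2))) =ᶠ[𝓝 p.1]
        (fun s => flowJacobian a U (s, p.2) * u (flow a U (s, p.2))) /
          fun s => flowJacobian a U (s, p.2) := by
      filter_upwards [Ioi_mem_nhds (mem_strip.1 hp)] with s hs
      have := (flowJacobian_pos hU ha hl hΩ ha_in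
        (mem_strip.2 hs : ((s, p.2) : ℝ × Transverse d) ∈ _)).ne'
      simp only [Pi.div_apply]
      field_simp
    refine (h1.congr_of_eventuallyEq hev).congr_deriv ?_
    simp only [Prod.mk.eta]
    field_simp
    ring
  · intro H
    refine (hJ.mul H).congr_deriv ?_
    simp only [Prod.mk.eta]
    ring

end Characteristics

/-! ### The linear equation along the characteristics -/

section LineSolution

variable {d : ℕ} {l : ℝ} {B : Type} [NormedAddCommGroup B] [NormedSpace ℝ B]

/-- The solution `y(s, ξ) = e^{-A(s, ξ)} (g(ξ) + ∫_0^s e^{A(r, ξ)} S(r, ξ) dr)`, with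
`A(s, ξ) = ∫_0^s c(r, ξ) dr`, of the equation `∂_s y + c y = S`, `y(0, ξ) = g(ξ)`. The data `g` and
`S` are vector valued. -/
def lineSolution (c : ℝ × Transverse d → ℝ) (g : Transverse d → B) (S : ℝ × Transverse d → B)
    (p : ℝ × Transverse d) : B :=
  Real.exp (-∫ r in (0 : ℝ)..p.1, c (r, p.2)) •
    (g p.2 + ∫ r in (0 : ℝ)..p.1, Real.exp (∫ q in (0 : ℝ)..r, c (q, p.2)) • S (r, p.2))

theorem lineSolution_zero (c : ℝ × Transverse d → ℝ) (g : Transverse d → B)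
    (S : ℝ × Transverse d → B) (ξ : Transverse d) : lineSolution c g S (0, ξ) = g ξ := by
  simp [lineSolution]

theorem strip_ray (hl : 0 < l) : ∀ p ∈ strip d l, ∀ t ∈ Icc (0 : ℝ) 1,
    ((t * p.1, p.2) : ℝ × Transverse d) ∈ strip d l := by
  intro p hp t ht
  rw [mem_strip] at hp ⊢
  have h1 : min 0 p.1 ≤ t * p.1 := by
    rcases le_total 0 p.1 with h | h
    · exact (min_le_left _ _).trans (mul_nonneg ht.1 h)
    · exact (min_le_right _ _).trans (by nlinarith [ht.2])
  exact (lt_min (by linarith) hp).trans_le h1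

theorem contDiffOn_lineSolution (hl : 0 < l) {k : ℕ} {c : ℝ × Transverse d → ℝ}
    {g : Transverse d → B} {S : ℝ × Transverse d → B} (hc : ContDiffOn ℝ k c (strip d l))
    (hg : ContDiff ℝ k g) (hS : ContDiffOn ℝ k S (strip d l)) :
    ContDiffOn ℝ k (lineSolution c g S) (strip d l) := by
  have hA : ContDiffOn ℝ k (fun p : ℝ × Transverse d => ∫ r in (0 : ℝ)..p.1, c (r, p.2))
      (strip d l) := contDiffOn_integral_fst (isOpen_strip d l) hc (strip_ray hl)
  have hI : ContDiffOn ℝ k (fun p : ℝ × Transverse d =>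
      ∫ r in (0 : ℝ)..p.1, Real.exp (∫ q in (0 : ℝ)..r, c (q, p.2)) • S (r, p.2)) (strip d l) :=
    contDiffOn_integral_fst (f := fun p : ℝ × Transverse d =>
      Real.exp (∫ q in (0 : ℝ)..p.1, c (q, p.2)) • S p)
      (isOpen_strip d l) (hA.exp.smul hS) (strip_ray hl)
  exact hA.neg.exp.smul ((hg.comp_contDiffOn contDiffOn_snd).add hI)

theorem hasDerivAt_lineSolution [CompleteSpace B] (hl : 0 < l) {c : ℝ × Transverse d → ℝ}
    {g : Transverse d → B} {S : ℝ × Transverse d → B} (hc : ContinuousOn c (strip d l))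
    (hS : ContinuousOn S (strip d l)) {p : ℝ × Transverse d} (hp : p ∈ strip d l) :
    HasDerivAt (fun s => lineSolution c g S (s, p.2)) (S p - c p • lineSolution c g S p) p.1 := by
  obtain ⟨s, ξ⟩ := p
  rw [mem_strip] at hp
  have hA : ∀ s, -l < s → HasDerivAt (fun s => ∫ r in (0 : ℝ)..s, c (r, ξ)) (c (s, ξ)) s :=
    fun s hs => hasDerivAt_integral_of_continuousOn hl (continuousOn_slice hc ξ) hs
  have hI : HasDerivAt (fun s => ∫ r in (0 : ℝ)..s,
      Real.exp (∫ q in (0 : ℝ)..r, c (q, ξ)) • S (r, ξ))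
      (Real.exp (∫ q in (0 : ℝ)..s, c (q, ξ)) • S (s, ξ)) s := by
    refine hasDerivAt_integral_of_continuousOn hl ?_ hp
    have : ContinuousOn (fun s => ∫ r in (0 : ℝ)..s, c (r, ξ)) (Ioi (-l)) := fun s hs =>
      (hA s hs).continuousAt.continuousWithinAt
    exact this.rexp.smul (continuousOn_slice hS ξ)
  refine ((hA s hp).neg.exp.smul (hI.const_add (g ξ))).congr_deriv ?_
  simp only [lineSolution, Pi.neg_apply]
  rw [smul_smul, ← Real.exp_add, neg_add_cancel, Real.exp_zero, one_smul, smul_smul, mul_neg,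
    mul_comm, neg_smul, sub_eq_add_neg]

/-- Uniqueness for `∂_s y + c y = S`, `y(0, ξ) = g(ξ)`. -/
theorem eqOn_lineSolution [CompleteSpace B] (hl : 0 < l) {c : ℝ × Transverse d → ℝ}
    {g : Transverse d → B} {S : ℝ × Transverse d → B} (hc : ContinuousOn c (strip d l))
    (hS : ContinuousOn S (strip d l)) {y : ℝ × Transverse d → B} (hy0 : ∀ ξ, y (0, ξ) = g ξ)
    (hy : ∀ p ∈ strip d l, HasDerivAt (fun s => y (s, p.2)) (S p - c p • y p) p.1) :
    EqOn y (lineSolution c g S) (strip d l) := by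
  rintro ⟨s, ξ⟩ hs
  rw [mem_strip] at hs
  -- the difference of two solutions, multiplied by `e^A`, has derivative zero
  set w : ℝ → B := fun s => Real.exp (∫ r in (0 : ℝ)..s, c (r, ξ)) •
    (y (s, ξ) - lineSolution c g S (s, ξ)) with hw
  have hwd : ∀ s ∈ Ioi (-l), HasDerivAt w 0 s := by
    intro s hs
    have hsm : ((s, ξ) : ℝ × Transverse d) ∈ strip d l := mem_strip.2 hs
    have hA : HasDerivAt (fun s => ∫ r in (0 : ℝ)..s, c (r, ξ)) (c (s, ξ)) s :=
      hasDerivAt_integral_of_continuousOn hl (continuousOn_slice hc ξ) hs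
    refine (hA.exp.smul ((hy _ hsm).sub (hasDerivAt_lineSolution hl hc hS hsm))).congr_deriv ?_
    simp only [Pi.sub_apply]
    module
  have hconst : w s = w 0 := by
    refine (convex_Ioi (-l)).is_const_of_fderivWithin_eq_zero (𝕜 := ℝ)
      (fun s hs => (hwd s hs).differentiableAt.differentiableWithinAt) (fun s hs => ?_) hs
      (by simpa using hl)
    rw [fderivWithin_of_isOpen isOpen_Ioi hs]
    ext
    simp [(hwd s hs).deriv]
  have h0 : w 0 = 0 := by simp [hw, hy0, lineSolution_zero]
  rw [h0, hw, smul_eq_zero] at hconst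
  exact sub_eq_zero.1 (hconst.resolve_left (Real.exp_pos _).ne')

/-- Continuous linear maps commute with the solution operator. -/
theorem map_lineSolution [CompleteSpace B] {B' : Type} [NormedAddCommGroup B'] [NormedSpace ℝ B']
    [CompleteSpace B'] (hl : 0 < l) {c : ℝ × Transverse d → ℝ}
    {g : Transverse d → B} {S : ℝ × Transverse d → B} (hc : ContinuousOn c (strip d l))
    (hS : ContinuousOn S (strip d l)) (L : B →L[ℝ] B') {p : ℝ × Transverse d}
    (hp : p ∈ strip d l) :
    L (lineSolution c g S p) = lineSolution c (fun ξ => L (g ξ)) (fun p => L (S p)) p := by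
  refine eqOn_lineSolution hl hc (L.continuous.comp_continuousOn hS)
    (y := fun p => L (lineSolution c g S p)) (fun ξ => by rw [lineSolution_zero]) ?_ hp
  intro p hp
  have : HasDerivAt (fun s => L (lineSolution c g S (s, p.2)))
      (L (S p - c p • lineSolution c g S p)) p.1 :=
    L.hasFDerivAt.comp_hasDerivAt p.1 (hasDerivAt_lineSolution (g := g) hl hc hS hp)
  exact this.congr_deriv (by simp)

end LineSolution

/-! ### Convergence in `C^k` and functions with values in a space of sequences -/

section Convergence

universe u

theorem JointContDiffOn.congr {T : Type*} [TopologicalSpace T] {E F : Type u}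
    [NormedAddCommGroup E] [NormedSpace ℝ E] [NormedAddCommGroup F] [NormedSpace ℝ F] {k : ℕ}
    {h h' : T → E → F} {V : Set E} (hV : IsOpen V) (H : JointContDiffOn k h V)
    (heq : ∀ t, EqOn (h' t) (h t) V) : JointContDiffOn k h' V := by
  refine ⟨fun t => (H.contDiffOn t).congr (heq t), fun j hj => (H.continuousOn j hj).congr ?_⟩
  rintro ⟨t, x⟩ ⟨-, hx⟩
  exact ((heq t).eventuallyEq_of_mem (hV.mem_nhds hx)).iteratedFDeriv ℝ j |>.self_of_nhds

theorem JointContDiffOn.succ_of_fderiv {T : Type*} [TopologicalSpace T] {E F : Type u}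
    [NormedAddCommGroup E] [NormedSpace ℝ E] [NormedAddCommGroup F] [NormedSpace ℝ F] {k : ℕ}
    {h : T → E → F} {V : Set E} (hV : IsOpen V)
    (hd : ∀ t, DifferentiableOn ℝ (h t) V)
    (hc : ContinuousOn (fun p : T × E => h p.1 p.2) (univ ×ˢ V))
    (H : JointContDiffOn k (fun t => _root_.fderiv ℝ (h t)) V) : JointContDiffOn (k + 1) h V := by
  refine ⟨fun t => ?_, fun j hj => ?_⟩
  · push_cast
    rw [contDiffOn_succ_iff_fderiv_of_isOpen hV]
    exact ⟨hd t, by simp, H.contDiffOn t⟩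
  · cases j with
    | zero =>
      refine ((continuousMultilinearCurryFin0 ℝ E F).symm.continuous.comp_continuousOn
        hc).congr fun p _ => ?_
      simp [iteratedFDeriv_zero_eq_comp]
    | succ j =>
      refine ((continuousMultilinearCurryRightEquiv' ℝ j E F).symm.continuous.comp_continuousOn
        (H.continuousOn j (by omega))).congr fun p _ => ?_
      simp [iteratedFDeriv_succ_eq_comp_right]

/-- For finite-dimensional `E`, a linear map from `E` to `C(T, F)` is a continuous family of linear
maps from `E` to `F`. -/
def swapEval (T : Type*) [TopologicalSpace T] [CompactSpace T] (E F : Type*)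
    [NormedAddCommGroup E] [NormedSpace ℝ E] [FiniteDimensional ℝ E] [NormedAddCommGroup F]
    [NormedSpace ℝ F] : (E →L[ℝ] C(T, F)) →L[ℝ] C(T, E →L[ℝ] F) :=
  LinearMap.mkContinuous (E := E →L[ℝ] C(T, F)) (F := C(T, E →L[ℝ] F))
    ({ toFun := fun L => ⟨fun t => (ContinuousMap.evalCLM ℝ t).comp L, by
        rw [continuous_clm_apply]
        exact fun y => (L y).continuous⟩
       map_add' := fun L M => by ext; simp
       map_smul' := fun c L => by ext; simp } : (E →L[ℝ] C(T, F)) →ₗ[ℝ] C(T, E →L[ℝ] F))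
    1 (fun L => by
      rw [ContinuousMap.norm_le _ (by positivity)]
      intro t
      refine ContinuousLinearMap.opNorm_le_bound _ (by positivity) fun x => ?_
      rw [one_mul]
      exact ((L x).norm_coe_le_norm t).trans (L.le_opNorm x))

/-- A `C^k` function with values in `C(T, F)` is a jointly `C^k` family of functions. -/
theorem jointContDiffOn_eval {T : Type*} [TopologicalSpace T] [CompactSpace T] {E F : Type u}
    [NormedAddCommGroup E] [NormedSpace ℝ E] [FiniteDimensional ℝ E] [NormedAddCommGroup F]
    [NormedSpace ℝ F] {k : ℕ} {G : E → C(T, F)} {V : Set E} (hV : IsOpen V)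
    (hG : ContDiffOn ℝ k G V) : JointContDiffOn k (fun t x => G x t) V := by
  have hcont : ContinuousOn (fun p : T × E => G p.2 p.1) (univ ×ˢ V) :=
    (hG.continuousOn.comp continuousOn_snd fun p hp => hp.2).eval continuousOn_fst
  induction k generalizing F with
  | zero =>
    refine ⟨fun t => ?_, fun j hj => ?_⟩
    · rw [Nat.cast_zero, contDiffOn_zero]
      exact (ContinuousMap.evalCLM (M := F) ℝ t).continuous.comp_continuousOn hG.continuousOn
    · obtain rfl : j = 0 := by omega
      refine ((continuousMultilinearCurryFin0 ℝ E F).symm.continuous.comp_continuousOn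
        hcont).congr fun p _ => ?_
      simp [iteratedFDeriv_zero_eq_comp]
  | succ k ih =>
    have hd : ∀ x ∈ V, HasFDerivAt G (fderiv ℝ G x) x := fun x hx =>
      ((hG.contDiffAt (hV.mem_nhds hx)).differentiableAt
        (by exact_mod_cast k.succ_ne_zero)).hasFDerivAt
    have hde : ∀ t, ∀ x ∈ V, HasFDerivAt (fun x => G x t) (swapEval T E F (fderiv ℝ G x) t) x :=
      fun t x hx => (ContinuousMap.evalCLM (M := F) ℝ t).hasFDerivAt.comp x (hd x hx)
    have hsw : ContDiff ℝ k (swapEval T E F) :=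
      ContinuousLinearMap.contDiff (𝕜 := ℝ) (E := E →L[ℝ] C(T, F)) (F := C(T, E →L[ℝ] F)) _
    have hG' : ContDiffOn ℝ k (fun x => swapEval T E F (fderiv ℝ G x)) V :=
      hsw.comp_contDiffOn (hG.fderiv_of_isOpen hV (m := k) (by norm_cast))
    refine .succ_of_fderiv hV
      (fun t x hx => (hde t x hx).differentiableAt.differentiableWithinAt) hcont ?_
    refine (ih hG' ?_).congr hV fun t x hx => (hde t x hx).fderiv
    exact (hG'.continuousOn.comp continuousOn_snd fun p hp => hp.2).eval continuousOn_fst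

variable {X : Type} [NormedAddCommGroup X] [NormedSpace ℝ X]

/-- A sequence and its limit as a family indexed by the one-point compactification of `ℕ`. -/
def withLimit {Y : Type*} (f : ℕ → Y) (f_lim : Y) (t : OnePoint ℕ) : Y := t.elim f_lim f

theorem continuousOn_iteratedFDeriv {Y : Type*} [NormedAddCommGroup Y] [NormedSpace ℝ Y]
    {V : Set X} (hV : IsOpen V) {k j : ℕ} (hj : j ≤ k) {f : X → Y} (hf : ContDiffOn ℝ k f V) :
    ContinuousOn (iteratedFDeriv ℝ j f) V :=
  (hf.continuousOn_iteratedFDerivWithin (by exact_mod_cast hj) hV.uniqueDiffOn).congr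
    fun _ hx => (iteratedFDerivWithin_of_isOpen j hV hx).symm

theorem TendstoCk.congr {V : Set X} (hV : IsOpen V) {k : ℕ} {f f' : ℕ → X → ℝ}
    {f_lim f_lim' : X → ℝ} (H : TendstoCk k V f f_lim) (hf : ∀ n, EqOn (f' n) (f n) V)
    (hf_lim : EqOn f_lim' f_lim V) : TendstoCk k V f' f_lim' := by
  have key : ∀ {p q : X → ℝ} (j : ℕ), EqOn p q V →
      EqOn (iteratedFDeriv ℝ j p) (iteratedFDeriv ℝ j q) V := fun j h x hx =>
    ((h.eventuallyEq_of_mem (hV.mem_nhds hx)).iteratedFDeriv ℝ j).self_of_nhds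
  intro j hj K hKV hK
  refine ((H j hj K hKV hK).congr ?_).congr_right ?_
  · exact Eventually.of_forall fun n x hx => (key j (hf n) (hKV hx)).symm
  · exact fun x hx => (key j hf_lim (hKV hx)).symm

variable [FiniteDimensional ℝ X]

/-- Locally uniform convergence of continuous functions, as joint continuity on
`(ℕ ∪ {∞}) × V`. -/
theorem continuousOn_withLimit_iff {Y : Type*} [NormedAddCommGroup Y] {V : Set X} (hV : IsOpen V)
    {h : OnePoint ℕ → X → Y} (hh : ∀ t, ContinuousOn (h t) V) :
    ContinuousOn (fun p : OnePoint ℕ × X => h p.1 p.2) (univ ×ˢ V) ↔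
    ∀ K ⊆ V, IsCompact K →
      TendstoUniformlyOn (fun n : ℕ => h n) (h OnePoint.infty) atTop K := by
  have : ProperSpace X := FiniteDimensional.proper ℝ X
  have : LocallyCompactSpace V := hV.locallyCompactSpace
  set H : OnePoint ℕ → C(V, Y) := fun t => ⟨V.domRestrict (h t), (hh t).domRestrict⟩ with hH
  have h1 : ContinuousOn (fun p : OnePoint ℕ × X => h p.1 p.2) (univ ×ˢ V) ↔ Continuous H := by
    constructor
    · intro hc
      refine ContinuousMap.continuous_of_continuous_uncurry _ ?_
      exact hc.comp_continuous (f := fun q : OnePoint ℕ × V => (q.1, (q.2 : X))) (by fun_prop)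
        fun q => ⟨mem_univ _, q.2.2⟩
    · intro hc
      rw [continuousOn_iff_continuous_domRestrict]
      have h2 : Continuous fun q : OnePoint ℕ × V => H q.1 q.2 :=
        (hc.comp continuous_fst).eval continuous_snd
      exact h2.comp (f := fun p : (univ ×ˢ V : Set (OnePoint ℕ × X)) => (p.1.1, ⟨p.1.2, p.2.2⟩))
        (by fun_prop)
  rw [h1, OnePoint.continuous_iff_from_nat,
    ContinuousMap.tendsto_iff_forall_isCompact_tendstoUniformlyOn]
  constructor
  · intro hc K hKV hK
    have h2 := hc ((↑) ⁻¹' K : Set V) (by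
      rw [Subtype.isCompact_iff, Subtype.image_preimage_coe, inter_eq_right.2 hKV]
      exact hK)
    intro s hs
    filter_upwards [h2 s hs] with n hn x hx
    exact hn ⟨x, hKV hx⟩ hx
  · intro hc K hK
    have h2 := hc ((↑) '' K) (by rintro _ ⟨x, -, rfl⟩; exact x.2)
      (hK.image continuous_subtype_val)
    intro s hs
    filter_upwards [h2 s hs] with n hn x hx
    exact hn x ⟨x, hx, rfl⟩

/-- Convergence in `C^k` of functions of class `C^k` amounts to the family indexed by `ℕ ∪ {∞}`
being jointly `C^k`. -/
theorem jointContDiffOn_withLimit_iff {V : Set X} (hV : IsOpen V) {k : ℕ} {f : ℕ → X → ℝ}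
    {f_lim : X → ℝ} (hf : ∀ n, ContDiffOn ℝ k (f n) V) (hf_lim : ContDiffOn ℝ k f_lim V) :
    JointContDiffOn k (withLimit f f_lim) V ↔ TendstoCk k V f f_lim := by
  have hall : ∀ t, ContDiffOn ℝ k (withLimit f f_lim t) V := by
    intro t
    induction t with
    | infty => exact hf_lim
    | coe n => exact hf n
  have key : ∀ j ≤ k, _ := fun j hj => continuousOn_withLimit_iff hV
    (h := fun t => iteratedFDeriv ℝ j (withLimit f f_lim t))
    fun t => continuousOn_iteratedFDeriv hV hj (hall t)
  exact ⟨fun H j hj => (key j hj).1 (H.continuousOn j hj),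
    fun H => ⟨hall, fun j hj => (key j hj).2 (H j hj)⟩⟩

/-- A sequence that converges in `C^k` is a `C^k` function with values in `C(ℕ ∪ {∞}, ℝ)`, the
Banach space of convergent sequences. -/
theorem TendstoCk.exists_contDiffOn {V : Set X} (hV : IsOpen V) {k : ℕ} {f : ℕ → X → ℝ}
    {f_lim : X → ℝ} (H : TendstoCk k V f f_lim) (hf : ∀ n, ContDiffOn ℝ k (f n) V)
    (hf_lim : ContDiffOn ℝ k f_lim V) :
    ∃ G : X → C(OnePoint ℕ, ℝ), ContDiffOn ℝ k G V ∧
      ∀ x ∈ V, ∀ t, G x t = withLimit f f_lim t x := by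
  have HJ := (jointContDiffOn_withLimit_iff hV hf hf_lim).2 H
  refine ⟨fun x => superposition (withLimit f f_lim)
    (ContinuousLinearMap.const ℝ (OnePoint ℕ) x), ?_, fun x hx t => ?_⟩
  · exact (contDiffOn_superposition hV HJ).comp
      (ContinuousLinearMap.const (M := X) ℝ (OnePoint ℕ)).contDiff.contDiffOn fun x hx t => hx
  · exact superposition_apply (γ := ContinuousLinearMap.const ℝ (OnePoint ℕ) x)
      HJ.continuousOn_uncurry (fun _ => hx) t

/-- Conversely, a `C^k` function with values in `C(ℕ ∪ {∞}, ℝ)` is a convergent sequence in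
`C^k`. -/
theorem tendstoCk_eval {V : Set X} (hV : IsOpen V) {k : ℕ} {G : X → C(OnePoint ℕ, ℝ)}
    (hG : ContDiffOn ℝ k G V) :
    TendstoCk k V (fun n x => G x (n : OnePoint ℕ)) (fun x => G x OnePoint.infty) := by
  have H := jointContDiffOn_eval hV hG
  refine (jointContDiffOn_withLimit_iff hV (fun n => H.contDiffOn n) (H.contDiffOn _)).1
    (H.congr hV fun t => ?_)
  induction t with
  | infty => exact fun _ _ => rfl
  | coe n => exact fun _ _ => rfl

end Convergence

/-! ### The transport problem -/

section Problem

variable {d : ℕ} {a : Space d → Space d} {U : Set (Space d)} {l : ℝ}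

/-- The coefficient `(div a + a₀) ∘ Φ` of the equation along the characteristics. -/
def flowCoefficient (a : Space d → Space d) (a₀ : Space d → ℝ) (U : Set (Space d))
    (p : ℝ × Transverse d) : ℝ :=
  divergence a (flow a U p) + a₀ (flow a U p)

variable (hU : IsOpen U) (ha : ContDiffOn ℝ 1 a U) (hl : 0 < l)
  (hΩ : strip d l ⊆ flowDomain a U) (ha_in : ∀ ξ : Transverse d, 0 < (a (0, ξ)).1)

include hU ha hl hΩ ha_in

theorem contDiffOn_flowCoefficient {m : ℕ} (ham : ContDiffOn ℝ (m + 1 : ℕ) a U)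
    {a₀ : Space d → ℝ} (ha₀ : ContDiffOn ℝ m a₀ U) :
    ContDiffOn ℝ m (flowCoefficient a a₀ U) (strip d l) := by
  have hΦ : ContDiffOn ℝ m (flow a U) (strip d l) :=
    (isDiffeoOn_flow hU ha hl hΩ m.succ_ne_zero ham ha_in).2.2.2.1.of_le
      (by exact_mod_cast m.le_succ)
  exact ((contDiffOn_divergence hU ham).add ha₀).comp hΦ fun p hp => flow_mem hU ha hl hΩ hp

/-- Along the characteristics, a weak solution is the solution of a linear differential
equation. -/
theorem IsWeakSolution.comp_flow_eqOn {a₀ S u : Space d → ℝ} {g : Transverse d → ℝ}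
    (hu : IsWeakSolution a a₀ S g (flowImage a U l) u)
    (ha₀ : ContinuousOn a₀ U) (hS : ContinuousOn S (flowImage a U l)) :
    EqOn (u ∘ flow a U) (lineSolution (flowCoefficient a a₀ U) g (S ∘ flow a U)) (strip d l) := by
  have hVU := flowImage_subset hU ha hl hΩ
  have hΦ := (contDiffOn_one_flow hU ha hl hΩ ha_in).continuousOn
  have hc : ContinuousOn (flowCoefficient a a₀ U) (strip d l) :=
    (contDiffOn_flowCoefficient hU ha hl hΩ ha_in (m := 0) (by exact_mod_cast ha)
      (contDiffOn_zero.2 ha₀)).continuousOn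
  refine eqOn_lineSolution hl hc (hS.comp hΦ (mapsTo_image _ _)) (fun ξ => ?_) ?_
  · rw [Function.comp_apply, flow_zero hU ha hl hΩ, hu.boundary]
  · exact (weak_equation_iff hU ha hl hΩ ha_in hu.continuousOn (ha₀.mono hVU) hS).1 hu.equation

/-- Conversely, a solution of the linear equation along the characteristics is a weak solution. -/
theorem isWeakSolution_of_eqOn {a₀ S u : Space d → ℝ} {g : Transverse d → ℝ}
    (huc : ContinuousOn u (flowImage a U l))
    (hu : EqOn (u ∘ flow a U) (lineSolution (flowCoefficient a a₀ U) g (S ∘ flow a U)) (strip d l))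
    (ha₀ : ContinuousOn a₀ U) (hS : ContinuousOn S (flowImage a U l)) :
    IsWeakSolution a a₀ S g (flowImage a U l) u := by
  have hVU := flowImage_subset hU ha hl hΩ
  have hΦ := (contDiffOn_one_flow hU ha hl hΩ ha_in).continuousOn
  have hc : ContinuousOn (flowCoefficient a a₀ U) (strip d l) :=
    (contDiffOn_flowCoefficient hU ha hl hΩ ha_in (m := 0) (by exact_mod_cast ha)
      (contDiffOn_zero.2 ha₀)).continuousOn
  refine ⟨huc, (weak_equation_iff hU ha hl hΩ ha_in huc (ha₀.mono hVU) hS).2 ?_, fun ξ => ?_⟩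
  · intro p hp
    have hev : (fun s => u (flow a U (s, p.2))) =ᶠ[𝓝 p.1] fun s =>
        lineSolution (flowCoefficient a a₀ U) g (S ∘ flow a U) (s, p.2) := by
      filter_upwards [Ioi_mem_nhds (mem_strip.1 hp)] with s hs
      exact hu (mem_strip.2 hs)
    refine ((hasDerivAt_lineSolution hl hc (hS.comp hΦ (mapsTo_image _ _))
      hp).congr_of_eventuallyEq hev).congr_deriv ?_
    rw [← hu hp]
    rfl
  · have := hu (zero_mem_strip hl ξ)
    rwa [Function.comp_apply, flow_zero hU ha hl hΩ, lineSolution_zero] at this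

/-- For `u` of class `C¹`, the pointwise equation is the equation along the characteristics, hence
classical solutions and weak solutions of class `C¹` are the same. -/
theorem isClassicalSolution_iff {a₀ S u : Space d → ℝ} {g : Transverse d → ℝ}
    (huC : ContDiffOn ℝ 1 u (flowImage a U l)) (ha₀ : ContinuousOn a₀ U)
    (hS : ContinuousOn S (flowImage a U l)) :
    IsClassicalSolution a a₀ S g (flowImage a U l) u ↔
      IsWeakSolution a a₀ S g (flowImage a U l) u := by
  have hV := isOpen_flowImage hU ha hl hΩ ha_in
  have hVU := flowImage_subset hU ha hl hΩ
  have hud : ∀ x ∈ flowImage a U l, DifferentiableAt ℝ u x := fun x hx =>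
    (huC.contDiffAt (hV.mem_nhds hx)).differentiableAt (by norm_num)
  have had : ∀ x ∈ flowImage a U l, DifferentiableAt ℝ a x := fun x hx =>
    (ha.contDiffAt (hU.mem_nhds (hVU hx))).differentiableAt (by norm_num)
  have hderiv : ∀ p ∈ strip d l, HasDerivAt (fun s => u (flow a U (s, p.2)))
      (fderiv ℝ u (flow a U p) (a (flow a U p))) p.1 := fun p hp =>
    HasFDerivAt.comp_hasDerivAt p.1 (f := fun s => flow a U (s, p.2))
      (hud _ (mem_image_of_mem _ hp)).hasFDerivAt
      (hasDerivAt_flow hU ha hl hΩ (mem_strip.1 hp))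
  have hiff := weak_equation_iff hU ha hl hΩ ha_in huC.continuousOn (ha₀.mono hVU) hS
  constructor
  · intro h
    refine ⟨huC.continuousOn, hiff.2 fun p hp => (hderiv p hp).congr_deriv ?_, h.boundary⟩
    have hx : flow a U p ∈ flowImage a U l := mem_image_of_mem _ hp
    have := h.equation _ hx
    rw [divergence_smul (hud _ hx) (had _ hx)] at this
    linarith
  · intro h
    refine ⟨huC, ?_, h.boundary⟩
    rintro _ ⟨p, hp, rfl⟩
    have hx : flow a U p ∈ flowImage a U l := mem_image_of_mem _ hp
    have := (hderiv p hp).unique (hiff.1 h.equation p hp)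
    rw [divergence_smul (hud _ hx) (had _ hx), this]
    ring

theorem IsClassicalSolution.isWeakSolution {a₀ S u : Space d → ℝ} {g : Transverse d → ℝ}
    (h : IsClassicalSolution a a₀ S g (flowImage a U l) u) (ha₀ : ContinuousOn a₀ U)
    (hS : ContinuousOn S (flowImage a U l)) : IsWeakSolution a a₀ S g (flowImage a U l) u :=
  (isClassicalSolution_iff hU ha hl hΩ ha_in h.contDiffOn ha₀ hS).1 h

/-- Continuous dependence of weak solutions on the data `g` and `S`. The solution formula, applied
to data with values in the space of convergent sequences, gives a `C^k` function with values in that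
space. -/
theorem tendstoCk_of_isWeakSolution {k : ℕ} (hak : ContDiffOn ℝ (k + 1 : ℕ) a U)
    {a₀ S u : Space d → ℝ} {g : Transverse d → ℝ} (ha₀ : ContDiffOn ℝ k a₀ U)
    (hg : ContDiff ℝ k g) (hS : ContDiffOn ℝ k S (flowImage a U l))
    (hu : IsWeakSolution a a₀ S g (flowImage a U l) u)
    {gs : ℕ → Transverse d → ℝ} {Ss us : ℕ → Space d → ℝ}
    (hgs : ∀ n, ContDiff ℝ k (gs n)) (hSs : ∀ n, ContDiffOn ℝ k (Ss n) (flowImage a U l))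
    (hus : ∀ n, IsWeakSolution a a₀ (Ss n) (gs n) (flowImage a U l) (us n))
    (hgt : TendstoCk k univ gs g) (hSt : TendstoCk k (flowImage a U l) Ss S) :
    TendstoCk k (flowImage a U l) us u := by
  have hV := isOpen_flowImage hU ha hl hΩ ha_in
  have hc := contDiffOn_flowCoefficient hU ha hl hΩ ha_in hak ha₀
  obtain ⟨-, -, -, hΦ, Ψ, hinv, hΨ⟩ := isDiffeoOn_flow hU ha hl hΩ k.succ_ne_zero hak ha_in
  have hk1 : ((k : ℕ∞) : WithTop ℕ∞) ≤ ((k + 1 : ℕ) : ℕ∞) := by exact_mod_cast k.le_succ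
  have hΦk : ContDiffOn ℝ k (flow a U) (strip d l) := hΦ.of_le hk1
  have hΨk : ContDiffOn ℝ k Ψ (flowImage a U l) := hΨ.of_le hk1
  have hmaps : MapsTo (flow a U) (strip d l) (flowImage a U l) := mapsTo_image _ _
  have hmaps' : MapsTo Ψ (flowImage a U l) (strip d l) := by
    rintro _ ⟨p, hp, rfl⟩
    rwa [hinv.1 hp]
  obtain ⟨G, hG, hGt⟩ := hgt.exists_contDiffOn isOpen_univ (fun n => (hgs n).contDiffOn)
    hg.contDiffOn
  obtain ⟨R, hR, hRt⟩ := hSt.exists_contDiffOn hV hSs hS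
  have hRΦ : ContDiffOn ℝ k (R ∘ flow a U) (strip d l) := hR.comp hΦk hmaps
  set Y : Space d → C(OnePoint ℕ, ℝ) := fun x =>
    lineSolution (flowCoefficient a a₀ U) G (R ∘ flow a U) (Ψ x) with hY
  have hYk : ContDiffOn ℝ k Y (flowImage a U l) :=
    (contDiffOn_lineSolution hl hc (contDiffOn_univ.1 hG) hRΦ).comp hΨk hmaps'
  have key : ∀ (t : OnePoint ℕ) (g' : Transverse d → ℝ) (S' u' : Space d → ℝ),
      (∀ ξ, G ξ t = g' ξ) → (∀ x ∈ flowImage a U l, R x t = S' x) →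
      ContDiffOn ℝ k S' (flowImage a U l) → IsWeakSolution a a₀ S' g' (flowImage a U l) u' →
      EqOn u' (fun x => Y x t) (flowImage a U l) := by
    intro t g' S' u' hg' hS' hS'k hu' x hx
    have h1 := hu'.comp_flow_eqOn hU ha hl hΩ ha_in ha₀.continuousOn hS'k.continuousOn (hmaps' hx)
    rw [Function.comp_apply, hinv.2 hx] at h1
    have h2 := map_lineSolution (g := G) hl hc.continuousOn hRΦ.continuousOn
      (ContinuousMap.evalCLM (M := ℝ) ℝ t) (hmaps' hx)
    refine h1.trans (Eq.trans ?_ h2.symm)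
    -- the source terms `S' ∘ Φ` and `(R ∘ Φ) t` agree on the strip only, so the two formulas are
    -- compared by uniqueness
    refine (eqOn_lineSolution hl hc.continuousOn ?_ ?_ ?_ (hmaps' hx)).symm
    · exact (hS'k.comp hΦk hmaps).continuousOn
    · intro ξ
      rw [lineSolution_zero]
      exact hg' ξ
    · intro p hp
      have hcont : ContinuousOn
          (fun p => ContinuousMap.evalCLM (M := ℝ) ℝ t ((R ∘ flow a U) p)) (strip d l) :=
        (ContinuousMap.evalCLM (M := ℝ) ℝ t).continuous.comp_continuousOn hRΦ.continuousOn
      refine (hasDerivAt_lineSolution hl hc.continuousOn hcont hp).congr_deriv ?_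
      rw [show ContinuousMap.evalCLM (M := ℝ) ℝ t ((R ∘ flow a U) p) = (S' ∘ flow a U) p from
        hS' _ (hmaps hp)]
  refine (tendstoCk_eval hV hYk).congr hV (fun n => ?_) ?_
  · exact key n (gs n) (Ss n) (us n) (fun ξ => hGt ξ (mem_univ _) n) (fun x hx => hRt x hx n)
      (hSs n) (hus n)
  · exact key OnePoint.infty g S u (fun ξ => hGt ξ (mem_univ _) _) (fun x hx => hRt x hx _) hS hu

end Problem

end Transport

end

theorem mainTheorem4 (d : ℕ) (hd : 2 ≤ d) (m : ℕ)
    (U : Set (Transport.Space d)) (hU : IsOpen U)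
    (hUhalf : ∀ x : Transport.Space d, 0 ≤ x.1 → x ∈ U)
    (a : Transport.Space d → Transport.Space d) (a₀ S : Transport.Space d → ℝ)
    (g : Transport.Transverse d → ℝ)
    (ha_in : ∀ ξ : Transport.Transverse d, 0 < (a (0, ξ)).1)
    (ha : ContDiffOn ℝ (m + 1 : ℕ) a U) (hg : ContDiff ℝ m g)
    (ha₀ : ContDiffOn ℝ m a₀ U) (hS : ContDiffOn ℝ m S U)
    (l : ℝ) (hl : 0 < l) (hΩ : Transport.strip d l ⊆ Transport.flowDomain a U) :
    -- the flow is a diffeomorphism of class `C^(m+1)`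
    (Transport.flowImage a U l ⊆ U ∧
      Transport.IsDiffeoOn (m + 1) (Transport.flow a U) (Transport.strip d l)
        (Transport.flowImage a U l)) ∧
    -- existence of a solution of class `C^m`, classical if `m ≥ 1`
    ∃ u : Transport.Space d → ℝ,
      ContDiffOn ℝ m u (Transport.flowImage a U l) ∧
      Transport.IsWeakSolution a a₀ S g (Transport.flowImage a U l) u ∧
      (1 ≤ m → Transport.IsClassicalSolution a a₀ S g (Transport.flowImage a U l) u) ∧
      -- uniqueness, among weak and among classical solutions
      (∀ v : Transport.Space d → ℝ,
        Transport.IsWeakSolution a a₀ S g (Transport.flowImage a U l) v ∨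
          Transport.IsClassicalSolution a a₀ S g (Transport.flowImage a U l) v →
        Set.EqOn v u (Transport.flowImage a U l)) ∧
      -- continuous dependence on the data `g` and `S`
      (∀ k ≤ m, ∀ (gs : ℕ → Transport.Transverse d → ℝ) (Ss us : ℕ → Transport.Space d → ℝ),
        (∀ n, ContDiff ℝ m (gs n)) →
        (∀ n, ContDiffOn ℝ m (Ss n) (Transport.flowImage a U l)) →
        (∀ n, Transport.IsWeakSolution a a₀ (Ss n) (gs n) (Transport.flowImage a U l) (us n)) →
        Transport.TendstoCk k Set.univ gs g →
        Transport.TendstoCk k (Transport.flowImage a U l) Ss S →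
        Transport.TendstoCk k (Transport.flowImage a U l) us u) := by

  have ha1 : ContDiffOn ℝ 1 a U := ha.of_le (by exact_mod_cast Nat.le_add_left 1 m)
  have hVU := Transport.flowImage_subset hU ha1 hl hΩ
  have hdiff := Transport.isDiffeoOn_flow hU ha1 hl hΩ m.succ_ne_zero ha ha_in
  refine ⟨⟨hVU, hdiff⟩, ?_⟩
  obtain ⟨-, -, -, hΦ, Ψ, hinv, hΨ⟩ := hdiff
  have hm1 : ((m : ℕ∞) : WithTop ℕ∞) ≤ ((m + 1 : ℕ) : ℕ∞) := by exact_mod_cast m.le_succ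
  have hSV : ContDiffOn ℝ m S (Transport.flowImage a U l) := hS.mono hVU
  have hmaps' : Set.MapsTo Ψ (Transport.flowImage a U l) (Transport.strip d l) := by
    rintro _ ⟨p, hp, rfl⟩
    rwa [hinv.1 hp]
  set y := Transport.lineSolution (Transport.flowCoefficient a a₀ U) g (S ∘ Transport.flow a U)
    with hy
  have huC : ContDiffOn ℝ m (y ∘ Ψ) (Transport.flowImage a U l) :=
    (Transport.contDiffOn_lineSolution hl
      (Transport.contDiffOn_flowCoefficient hU ha1 hl hΩ ha_in ha ha₀) hg
      (hSV.comp (hΦ.of_le hm1) (Set.mapsTo_image _ _))).comp (hΨ.of_le hm1) hmaps'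
  have hweak : Transport.IsWeakSolution a a₀ S g (Transport.flowImage a U l) (y ∘ Ψ) :=
    Transport.isWeakSolution_of_eqOn hU ha1 hl hΩ ha_in huC.continuousOn
      (fun p hp => by simp only [Function.comp_apply, hinv.1 hp, hy]) ha₀.continuousOn
      hSV.continuousOn
  refine ⟨y ∘ Ψ, huC, hweak, fun hm => ?_, fun v hv => ?_, ?_⟩
  · exact (Transport.isClassicalSolution_iff hU ha1 hl hΩ ha_in
      (huC.of_le (by exact_mod_cast hm)) ha₀.continuousOn hSV.continuousOn).2 hweak
  · have hv' : Transport.IsWeakSolution a a₀ S g (Transport.flowImage a U l) v :=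
      hv.elim id fun h => h.isWeakSolution hU ha1 hl hΩ ha_in ha₀.continuousOn hSV.continuousOn
    intro x hx
    have := hv'.comp_flow_eqOn hU ha1 hl hΩ ha_in ha₀.continuousOn hSV.continuousOn (hmaps' hx)
    rwa [Function.comp_apply, hinv.2 hx] at this
  · intro k hk gs Ss us hgs hSs hus hgt hSt
    have hkm : ((k : ℕ∞) : WithTop ℕ∞) ≤ (m : ℕ∞) := by exact_mod_cast hk
    exact Transport.tendstoCk_of_isWeakSolution hU ha1 hl hΩ ha_in
      (ha.of_le (by exact_mod_cast Nat.succ_le_succ hk)) (ha₀.of_le hkm) (hg.of_le hkm)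
      (hSV.of_le hkm) hweak (fun n => (hgs n).of_le hkm) (fun n => (hSs n).of_le hkm) hus hgt hSt
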